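/- Let $A=(a_{ij})$ be a Cartan matrix of finite type and $d_i$ positive integers with $d_ia_{ij}=d_ja_{ji}$ (in the usual normalization $d_i\in\{1,2,3\}$, and all $d_i=1$ if $A$ is simply laced). Let $\alpha_i$ be the simple roots, $(\alpha_i,\alpha_j)=d_ia_{ij}$ the invariant form, $\Lambda_i$ the fundamental weights, $(\Lambda_i,\alpha_j)=d_i\delta_{ij}$, and $s_i$ the simple reflections, $s_i\alpha_j=\alpha_j-a_{ij}\alpha_i$. Let $\omega=s_{i_1}\cdots s_{i_r}$ be a reduced expression in the Weyl group, $\omega_n=s_{i_1}\cdots s_{i_n}$, $\beta_n=\omega_{n-1}(\alpha_{i_n})$, and let $r_0=|\{i_1,\dots,i_r\}|$. For $q\in\mathbb C^\ast$ not a root of unity let $\overline{\mathcal L}_q$ be the quasi-Laurent algebra over $\mathbb C$ with generators $z_1^{\pm1},\dots,z_r^{\pm1}$ and relations $z_mz_n=q^{(\beta_m,\beta_n)}z_nz_m$ for $m<n$; its center is called the $q$-generic center, and it is trivial if it equals $\mathbb C$. Put $M_n=\prod_{m\le n,\ i_m=i_n}z_m$, and let $\mathcal L$ be the skew-symmetric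 integer $r\times r$ matrix of the elements $M_n$: $M_mM_n=q^{\mathcal L_{mn}}M_nM_m$; explicitly $\mathcal L=\mathbb A\mathcal L_0\mathbb A^t$, where $\mathcal L_0$ is the skew-symmetric matrix with entries $(\beta_m,\beta_n)$ for $m<n$ and the rows of $\mathbb A$ are the exponent vectors of the $M_n$. Let $N$ be the set of the $r-r_0$ positions $n$ whose letter $i_n$ occurs again at a later position, and order the positions so that those in $N$ come first. (a) There is an integer matrix $G$ with $\det G=1$ such that $$\mathcal L\,G=\begin{pmatrix}D&Y\\0&Z\end{pmatrix},\qquad D=\operatorname{diag}(2d_{i_n})_{n\in N}$$ (so $D=2I_{r-r_0}$ in the simply laced case with all $d_i=1$). Moreover $G$ can be chosen such that the entry of the $r_0\times r_0$ matrix $Z$ in the row of the letter $s$ and the column of the letter $c$ is $\pm\left((1+\omega)\Lambda_s,(1-\omega_{c,1})\Lambda_c\right)$, with a sign that depends only on $c$, where $\omega_{c,1}=\omega_n$ for the first position $n$ with $i_n=c$. (b) $\mathcal L$ has a block diagonal form, that is, there is an integer matrix $U$ with $\det U=1$ such that, in a suitable order of the basis vectors, $U\mathcal LU^t$ is block diagonal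 with blocks $\begin{pmatrix}0&p\\-p&0\end{pmatrix}$, $p\in\mathbb Z$, and zero blocks of size one. For every column reduction $\mathcal LG=\begin{pmatrix}D&Y\\0&Z\end{pmatrix}$ with $G$ integral and $\det G=1$ the following hold. (c) For every $q\in\mathbb C^\ast$ that is not a root of unity, the $q$-generic center is trivial if and only if $\det Z\ne0$. Equivalently, $1+\omega$ has trivial kernel if and only if $\det Z\neq 0$. (d) $\det\mathcal L=2^{r-r_0}\Big(\prod_{n\in N}d_{i_n}\Big)\det Z$. (e) If $\begin{pmatrix}0&p\\-p&0\end{pmatrix}$ is a block of a block diagonal form of $\mathcal L$, then $p^2$ divides $2^{r-r_0}\big(\prod_{n\in N}d_{i_n}\big)\det Z$. (f) Let $p_1\ne2$ be a prime that does not divide $\prod_{n\in N}d_{i_n}$, and let $p_1^t$ be the exact power of $p_1$ in $\det Z$ (so $\det Z\ne0$). Then $t$ is even, and in every block diagonal form of $\mathcal L$ each block $\begin{pmatrix}0&p^{(i)}\\-p^{(i)}&0\end{pmatrix}$ satisfies $|p^{(i)}|=u_ip_1^{s_i}$ with $u_i$ a positive integer prime to $p_1$, $s_i\ge0$, and $2\sum_is_i=t$.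 -/

import Mathlib

/-- A Cartan matrix `A` of finite type (possibly decomposable), together with positive integers
`d i` for which `diagonal d * A` is symmetric and positive definite.
The convention is `A i j = 2 (α_i, α_j) / (α_i, α_i)`, with `(α_i, α_j) = d i * A i j`,
so `d i = (α_i, α_i) / 2`. -/
structure CartanDatum (ι : Type*) [Fintype ι] [DecidableEq ι] where
  A : Matrix ι ι ℤ
  d : ι → ℤ
  diag : ∀ i, A i i = 2
  offDiag : ∀ i j, i ≠ j → A i j ≤ 0
  d_pos : ∀ i, 0 < d i
  symm : ∀ i j, d i * A i j = d j * A j i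
  posDef : ((Matrix.diagonal d * A).map (fun z : ℤ => (z : ℝ))).PosDef

namespace CartanDatum

variable {ι : Type*} [Fintype ι] [DecidableEq ι] (C : CartanDatum ι)

/-- The invariant form. A vector `x : ι → K` stands for `∑ i, x i • α_i`. -/
def form (K : Type*) [CommRing K] (x y : ι → K) : K :=
  ∑ i, ∑ j, x i * ((C.d i * C.A i j : ℤ) : K) * y j

/-- The simple reflection `s_i`, in coordinates with respect to the simple roots:
`s_i α_j = α_j - A i j • α_i`. -/
def simpleReflection (K : Type*) [CommRing K] (i : ι) : Module.End K (ι → K) where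
  toFun x := x - (∑ j, ((C.A i j : ℤ) : K) * x j) • Pi.single i 1
  map_add' x y := by
    simp only [Pi.add_apply, mul_add, Finset.sum_add_distrib, add_smul]
    abel
  map_smul' c x := by
    have h : ∑ j, ((C.A i j : ℤ) : K) * (c * x j) = c * ∑ j, ((C.A i j : ℤ) : K) * x j := by
      rw [Finset.mul_sum]
      exact Finset.sum_congr rfl fun j _ => by ring
    simp only [Pi.smul_apply, smul_eq_mul, RingHom.id_apply, h, smul_sub, mul_smul]

/-- The Weyl group element `s_{i_1} ⋯ s_{i_r}` of a word `[i_1, …, i_r]`. -/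
def weylElt (K : Type*) [CommRing K] (w : List ι) : Module.End K (ι → K) :=
  (w.map (C.simpleReflection K)).prod

/-- The word is a reduced expression: no shorter word represents the same element. -/
def IsReduced (w : List ι) : Prop :=
  ∀ w' : List ι, C.weylElt ℤ w' = C.weylElt ℤ w → w.length ≤ w'.length

/-- The root `β_n = s_{i_1} ⋯ s_{i_{n-1}} (α_{i_n})` (with `n` counted from `0` in the code). -/
def root (w : List ι) (n : Fin w.length) : ι → ℤ :=
  C.weylElt ℤ (w.take n) (Pi.single (w.get n) 1)

/-- The fundamental weight `Λ_s` in simple root coordinates: `(α_j, Λ_s) = d s` if `j = s` and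
`0` otherwise. -/
noncomputable def fundWeight (s : ι) : ι → ℝ :=
  ((Matrix.diagonal C.d * C.A).map (fun z : ℤ => (z : ℝ)))⁻¹.mulVec (Pi.single s (C.d s : ℝ))

/-- The skew form of the generators `z_1, …, z_r`: `(β_m, β_n)` above the diagonal. -/
def formL₀ (w : List ι) : Matrix (Fin w.length) (Fin w.length) ℤ :=
  Matrix.of fun m n =>
    if m < n then C.form ℤ (C.root w m) (C.root w n)
    else if n < m then -C.form ℤ (C.root w m) (C.root w n)
    else 0

end CartanDatum

section Word

variable {ι : Type*} [DecidableEq ι] (w : List ι)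

/-- Row `n` is the exponent vector of `M_n = ∏ z_m`, the product over all positions `m ≤ n` that
carry the same letter as position `n`. -/
def minorExponents : Matrix (Fin w.length) (Fin w.length) ℤ :=
  Matrix.of fun n m => if m ≤ n ∧ w.get m = w.get n then 1 else 0

/-- The letter at position `n` occurs again later in the word. -/
def IsRepeated (n : Fin w.length) : Prop := ∃ m, n < m ∧ w.get m = w.get n

instance : DecidablePred (IsRepeated w) := fun n =>
  inferInstanceAs (Decidable (∃ m, n < m ∧ w.get m = w.get n))

/-- The positions that are not the last occurrence of their letter. -/
abbrev NonLast : Type := {n : Fin w.length // IsRepeated w n}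

/-- The positions that are the last occurrence of their letter; there is one for each letter
which occurs in the word. -/
abbrev Last : Type := {n : Fin w.length // ¬ IsRepeated w n}

end Word

namespace CartanDatum

variable {ι : Type*} [Fintype ι] [DecidableEq ι] (C : CartanDatum ι)

/-- The skew form of the elements `M_1, …, M_r`. -/
def formL (w : List ι) : Matrix (Fin w.length) (Fin w.length) ℤ :=
  minorExponents w * C.formL₀ w * (minorExponents w).transpose

/-- `formL * G`, with the last occurrences listed after the other positions (in rows and columns),
is the block matrix `[[diag(2 d), Y], [0, Z]]`. -/
def IsColumnReduction (w : List ι) (G : Matrix (Fin w.length) (Fin w.length) ℤ)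
    (Y : Matrix (NonLast w) (Last w) ℤ) (Z : Matrix (Last w) (Last w) ℤ) : Prop :=
  G.det = 1 ∧
    (C.formL w * G).submatrix (Equiv.sumCompl (IsRepeated w)) (Equiv.sumCompl (IsRepeated w)) =
      Matrix.fromBlocks (Matrix.diagonal fun n : NonLast w => 2 * C.d (w.get n.1)) Y 0 Z

end CartanDatum

/-- The defining relations of the quasi-Laurent algebra of an integer matrix `L`; `Sum.inl i` is
the generator `z_i` and `Sum.inr i` its inverse. -/
inductive QuasiLaurentRel {r : ℕ} (q : ℂ) (L : Matrix (Fin r) (Fin r) ℤ) :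
    FreeAlgebra ℂ (Fin r ⊕ Fin r) → FreeAlgebra ℂ (Fin r ⊕ Fin r) → Prop
  | mul_inv (i : Fin r) : QuasiLaurentRel q L
      (FreeAlgebra.ι ℂ (Sum.inl i) * FreeAlgebra.ι ℂ (Sum.inr i)) 1
  | inv_mul (i : Fin r) : QuasiLaurentRel q L
      (FreeAlgebra.ι ℂ (Sum.inr i) * FreeAlgebra.ι ℂ (Sum.inl i)) 1
  | comm (i j : Fin r) (h : i < j) : QuasiLaurentRel q L
      (FreeAlgebra.ι ℂ (Sum.inl i) * FreeAlgebra.ι ℂ (Sum.inl j))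
      ((q ^ L i j) • (FreeAlgebra.ι ℂ (Sum.inl j) * FreeAlgebra.ι ℂ (Sum.inl i)))

/-- The quasi-Laurent algebra: generators `z_i^{±1}`, relations
`z_i z_j = q ^ (L i j) z_j z_i` for `i < j`. -/
abbrev QuasiLaurent {r : ℕ} (q : ℂ) (L : Matrix (Fin r) (Fin r) ℤ) : Type :=
  RingQuot (QuasiLaurentRel q L)

/-- `L` is brought by an integral change of basis of determinant `1` into a block diagonal matrix
with blocks `[[0, p i], [-p i, 0]]` (`i : Fin k`) and `l` zero blocks of size one, after the basis
vectors are listed in the order given by a bijection. -/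
def IsBlockDiagonalForm {r : ℕ} (L : Matrix (Fin r) (Fin r) ℤ) (k l : ℕ) (p : Fin k → ℤ) : Prop :=
  ∃ (U : Matrix (Fin r) (Fin r) ℤ) (e : (Fin 2 × Fin k) ⊕ Fin l ≃ Fin r), U.det = 1 ∧
    (U * L * U.transpose).submatrix e e =
      Matrix.fromBlocks (Matrix.blockDiagonal fun i => !![0, p i; -p i, 0]) 0 0 0

/-! Write ω_n for the product of the first n simple reflections and ξ_m = ω_m Λ_{i_m}. The
displacement x - ω_n x is the sum of the roots β_k, k ≤ n, weighted by the coroot values of x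
(`sum_corootVal_smul_realRoot`). Two cases of this drive the column reduction. For x = Λ_s only the
letter s contributes, so the roots in M_m add up to Λ_{i_m} - ξ_m. Hence the exponent of M_m against
z_k is (β_k, Λ_{i_m} - ξ_m) for k > m and (β_k, Λ_{i_m} + ξ_m) for k ≤ m
(`minorExponents_mul_formL₀`). For x = α_{i_p} the displacement and β_p = ω_{p-1} α_{i_p} add up to
α_{i_p}. So the exchange vector of p pairs with M_m to (α_{i_p}, Λ_{i_m} + ξ_m), diminished by 2d if
m < p carries the letter of p (`sum_mul_exchangeVec`). For two consecutive positions n < n' of one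
letter the difference keeps 2d exactly at m = n, which gives D. The unit vectors at the first
occurrences supply the remaining columns and Z. These columns are triangular after a permutation,
with diagonal entries ±1. For the kernel, 1 + ω = 2 - PQ with P formed by the roots and Q by the
coroots, while 𝓛₀ is, up to sign, a nonsingular triangular matrix times 2 - QP. For the center, z_i
commutes with z^a up to q^{(𝓛₀ a)_i}, so the center is spanned by the monomials with 𝓛₀ a = 0. The
matrices 𝓛 and 𝓛₀ have the same determinant, and the column reduction expresses it through det Z.
The block form is the classification of alternating forms over ℤ. It makes det 𝓛 a product of
squares p², or 0, which yields the divisibility and prime power statements. -/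

/-! ### Normal form of integral alternating forms -/

/-- A finitely generated free `ℤ`-module with an alternating form has a basis in which the form is
an orthogonal sum of planes and a null space. -/
theorem exists_basis_alternating (n : ℕ) : ∀ {M : Type} [AddCommGroup M] [Module.Free ℤ M]
    [Module.Finite ℤ M] (B : M →ₗ[ℤ] M →ₗ[ℤ] ℤ), B.IsAlt → Module.finrank ℤ M = n →
    ∃ (k l : ℕ) (p : Fin k → ℤ) (b : Module.Basis ((Fin 2 × Fin k) ⊕ Fin l) ℤ M),
      ∀ i j, B (b i) (b j) =
        Matrix.fromBlocks (Matrix.blockDiagonal fun i => !![0, p i; -p i, 0]) 0 0 0 i j := by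
  induction n using Nat.strong_induction_on with
  | _ n ih =>
  intro M _ _ _ B hB hn
  by_cases h0 : ∀ x y, B x y = 0
  · refine ⟨0, n, Fin.elim0, (Module.finBasisOfFinrankEq ℤ M hn).reindex
      (Equiv.emptySum (Fin 2 × Fin 0) (Fin n)).symm, fun i j => ?_⟩
    rw [h0]
    rcases i with i | i
    · exact i.2.elim0
    rcases j with j | j
    · exact j.2.elim0
    simp
  push Not at h0
  -- The least positive value m of the form, attained at (x, y), becomes the entry of the first
  -- block.
  have hpos : ∃ m : ℕ, 0 < m ∧ ∃ x y, B x y = m := by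
    obtain ⟨x, y, hxy⟩ := h0
    rcases lt_or_gt_of_ne hxy with h | h
    · refine ⟨(B x y).natAbs, by omega, x, -y, ?_⟩
      rw [map_neg]; omega
    · exact ⟨(B x y).natAbs, by omega, x, y, by omega⟩
  classical
  obtain ⟨hm, x, y, hxy⟩ := Nat.find_spec hpos
  have hmin : ∀ x y, 0 < B x y → (Nat.find hpos : ℤ) ≤ B x y := fun x y h => by
    have := Nat.find_min' hpos (m := (B x y).natAbs) ⟨by omega, x, y, by omega⟩
    omega
  set m : ℕ := Nat.find hpos with hmdef
  have hm' : (0 : ℤ) < m := by exact_mod_cast hm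
  -- Subtracting a multiple of y from z replaces B x z by its remainder modulo m, which would be a
  -- smaller positive value.
  have hdy : ∀ z, (m : ℤ) ∣ B x z := fun z => by
    by_contra hnd
    have h1 := Int.emod_nonneg (B x z) hm'.ne'
    have h2 := Int.emod_lt_of_pos (B x z) hm'
    have h3 : B x z % m ≠ 0 := fun h => hnd (Int.dvd_of_emod_eq_zero h)
    have h4 : B x (z - (B x z / m) • y) = B x z % m := by
      rw [map_sub, map_smul, hxy, smul_eq_mul, Int.emod_def]; ring
    have := hmin x (z - (B x z / m) • y) (by omega)
    omega
  have hdx : ∀ z, (m : ℤ) ∣ B z y := fun z => by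
    by_contra hnd
    have h1 := Int.emod_nonneg (B z y) hm'.ne'
    have h2 := Int.emod_lt_of_pos (B z y) hm'
    have h3 : B z y % m ≠ 0 := fun h => hnd (Int.dvd_of_emod_eq_zero h)
    have h4 : B (z - (B z y / m) • x) y = B z y % m := by
      rw [map_sub, map_smul, LinearMap.sub_apply, LinearMap.smul_apply, hxy, smul_eq_mul,
        Int.emod_def]; ring
    have := hmin (z - (B z y / m) • x) y (by omega)
    omega
  have hyx : B y x = -m := by rw [← hB.neg, hxy]
  have hxx : B x x = 0 := hB x
  have hyy : B y y = 0 := hB y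
  -- The orthogonal complement of the plane spanned by x and y. By the two divisibilities the plane
  -- splits off over ℤ, and the induction runs on N.
  let N : Submodule ℤ M := LinearMap.ker (B x) ⊓ LinearMap.ker (B y)
  have hN : ∀ z : N, B x z = 0 ∧ B y z = 0 := fun z => z.2
  have hN' : ∀ z : N, B z x = 0 ∧ B z y = 0 := fun z => by
    rw [← hB.neg, ← hB.neg y]; simp [hN z]
  let f : ((Fin 2 → ℤ) × N) →ₗ[ℤ] M :=
    LinearMap.coprod (Fintype.linearCombination ℤ ![x, y]) N.subtype
  have hf : ∀ c z, f (c, z) = c 0 • x + c 1 • y + z := fun c z => by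
    simp [f, Fintype.linearCombination_apply]
  have hinj : Function.Injective f := by
    rw [injective_iff_map_eq_zero]
    rintro ⟨c, z⟩ h
    rw [hf] at h
    have h1 : B x (c 0 • x + c 1 • y + z) = 0 := by rw [h, map_zero]
    have h2 : B y (c 0 • x + c 1 • y + z) = 0 := by rw [h, map_zero]
    simp only [map_add, map_smul, hxx, hxy, hyx, hyy, hN z, smul_eq_mul] at h1 h2
    have c1 : c 1 = 0 := by
      have : c 1 * m = 0 := by linarith
      exact (mul_eq_zero.1 this).resolve_right hm'.ne'
    have c0 : c 0 = 0 := by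
      have : c 0 * m = 0 := by linarith
      exact (mul_eq_zero.1 this).resolve_right hm'.ne'
    rw [c0, c1] at h
    have hz : z = 0 := by simpa using h
    refine Prod.ext (funext fun i => ?_) hz
    fin_cases i <;> simp [c0, c1]
  have hsurj : Function.Surjective f := fun z => by
    obtain ⟨u, hu⟩ := hdy z
    obtain ⟨v, hv⟩ := hdx z
    have hv' : B y z = -(m * v) := by rw [← hB.neg, hv]
    refine ⟨(![v, u], ⟨z - v • x - u • y, ?_, ?_⟩), ?_⟩
    · simp [hxx, hxy, hu, mul_comm]
    · simp [hyy, hyx, hv', mul_comm]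
    · rw [hf]; simp
  let φ := LinearEquiv.ofBijective f ⟨hinj, hsurj⟩
  have hrank : Module.finrank ℤ N < n := by
    have := φ.finrank_eq
    rw [Module.finrank_prod, Module.finrank_fin_fun, hn] at this
    omega
  obtain ⟨k, l, p, b, hb⟩ := ih _ hrank (M := N) (B.domRestrict₁₂ N N) (fun z => hB z) rfl
  let e : Fin 2 ⊕ ((Fin 2 × Fin k) ⊕ Fin l) ≃ (Fin 2 × Fin (k + 1)) ⊕ Fin l :=
    { toFun := Sum.elim (fun a => Sum.inl (a, 0))
        (Sum.elim (fun c => Sum.inl (c.1, c.2.succ)) Sum.inr)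
      invFun := Sum.elim (fun c => Fin.cases (Sum.inl c.1) (fun i => Sum.inr (Sum.inl (c.1, i))) c.2)
        (fun i => Sum.inr (Sum.inr i))
      left_inv := by rintro (a | ⟨a, c⟩ | i) <;> simp
      right_inv := by
        rintro (⟨a, c⟩ | i)
        · refine Fin.cases ?_ (fun i => ?_) c <;> simp
        · simp }
  let b' := (((Pi.basisFun ℤ (Fin 2)).prod b).map φ).reindex e
  have b1 : ∀ a, b' (e (Sum.inl a)) = ![x, y] a := fun a => by
    have : b' (e (Sum.inl a)) = f (Pi.single a 1, 0) := by
      simp [b', φ]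
      rfl
    rw [this, hf]
    fin_cases a <;> simp
  have b2 : ∀ i, b' (e (Sum.inr i)) = b i := fun i => by
    have : b' (e (Sum.inr i)) = f (0, b i) := by
      simp [b', φ]
      rfl
    rw [this, hf]
    simp
  refine ⟨k + 1, l, Fin.cons m p, b', fun i j => ?_⟩
  obtain ⟨i, rfl⟩ := e.surjective i
  obtain ⟨j, rfl⟩ := e.surjective j
  rcases i with a | i
  · rcases j with c | j
    · rw [b1, b1]
      fin_cases a <;> fin_cases c <;> simp [e, hxx, hxy, hyx, hyy, Matrix.blockDiagonal_apply]
    · rw [b1, b2]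
      have : B (![x, y] a) (b j) = 0 := by
        fin_cases a
        · exact (hN _).1
        · exact (hN _).2
      rw [this]
      rcases j with ⟨c, j⟩ | j <;>
        simp [e, Matrix.blockDiagonal_apply, (Fin.succ_ne_zero _).symm]
  · rcases j with c | j
    · rw [b1, b2]
      have : B (b i) (![x, y] c) = 0 := by
        fin_cases c
        · exact (hN' _).1
        · exact (hN' _).2
      rw [this]
      rcases i with ⟨a, i⟩ | i <;>
        simp [e, Matrix.blockDiagonal_apply]
    · rw [b2, b2]
      have := hb i j
      rw [LinearMap.domRestrict₁₂_apply] at this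
      rw [this]
      rcases i with ⟨a, i⟩ | i <;> rcases j with ⟨c, j⟩ | j <;>
        simp [e, Matrix.blockDiagonal_apply]

/-- A skew-symmetric integer matrix has a block diagonal form. -/
theorem exists_isBlockDiagonalForm {r : ℕ} (L : Matrix (Fin r) (Fin r) ℤ)
    (hskew : ∀ i j, L j i = -L i j) :
    ∃ (k l : ℕ) (p : Fin k → ℤ), IsBlockDiagonalForm L k l p := by
  classical
  have hBapp : ∀ x y, Matrix.toLinearMap₂' ℤ L x y = x ⬝ᵥ L.mulVec y := fun x y =>
    Matrix.toLinearMap₂'_apply' L x y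
  have halt : (Matrix.toLinearMap₂' ℤ L).IsAlt := fun x => by
    rw [hBapp]
    have h1 : x ⬝ᵥ L.mulVec x = -(x ⬝ᵥ L.mulVec x) := by
      conv_lhs => rw [Matrix.dotProduct_mulVec, ← Matrix.mulVec_transpose]
      have : L.transpose = -L := by ext i j; simp [hskew i j]
      rw [this, Matrix.neg_mulVec, dotProduct_comm, dotProduct_neg]
    omega
  obtain ⟨k, l, p, b, hb⟩ := exists_basis_alternating r (Matrix.toLinearMap₂' ℤ L) halt
    (by simp)
  have e : (Fin 2 × Fin k) ⊕ Fin l ≃ Fin r := b.indexEquiv (Pi.basisFun ℤ (Fin r))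
  let U : Matrix (Fin r) (Fin r) ℤ := Matrix.of fun i => b (e.symm i)
  have hUL : ∀ V : Matrix (Fin r) (Fin r) ℤ, ∀ i j, (V * L * V.transpose) i j =
      Matrix.toLinearMap₂' ℤ L (V i) (V j) := fun V i j => by
    rw [hBapp, Matrix.mul_assoc, Matrix.mul_apply_eq_vecMul, Matrix.dotProduct_mulVec]
    simp [Matrix.vecMul, dotProduct, Matrix.mul_apply, Finset.mul_sum,
      Finset.sum_mul, mul_assoc]
    exact Finset.sum_comm
  have hdet : U.det = 1 ∨ U.det = -1 := by
    rw [← Int.isUnit_iff]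
    have h1 := (Pi.basisFun ℤ (Fin r)).isUnit_det (b.reindex e)
    rw [Module.Basis.det_apply] at h1
    have h2 : (Pi.basisFun ℤ (Fin r)).toMatrix (b.reindex e) = U.transpose := by
      ext i j
      simp [U, Module.Basis.toMatrix_apply]
    rwa [h2, Matrix.det_transpose] at h1
  rcases hdet with hdet | hdet
  · have hrow : ∀ i, U (e i) = b i := fun i => by ext; simp [U]
    refine ⟨k, l, p, U, e, hdet, ?_⟩
    ext i j
    rw [Matrix.submatrix_apply, hUL, ← hb, hrow, hrow]
  -- An orientation-reversing basis is repaired by negating one vector, which exists because an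
  -- empty determinant would be 1.
  · have hr : Nonempty ((Fin 2 × Fin k) ⊕ Fin l) := by
      by_contra hne
      rw [not_nonempty_iff] at hne
      have : IsEmpty (Fin r) := e.symm.isEmpty
      rw [Matrix.det_isEmpty] at hdet
      omega
    -- Negating a vector of a plane changes the sign of its p; negating a null vector changes
    -- nothing.
    obtain ⟨i₀, p', hp'⟩ : ∃ (i₀ : (Fin 2 × Fin k) ⊕ Fin l) (p' : Fin k → ℤ), ∀ i j,
        (if i = i₀ then (-1 : ℤ) else 1) * (if j = i₀ then -1 else 1) *
          Matrix.fromBlocks (Matrix.blockDiagonal fun i => !![0, p i; -p i, 0]) 0 0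
            (0 : Matrix (Fin l) (Fin l) ℤ) i j =
          Matrix.fromBlocks (Matrix.blockDiagonal fun i => !![0, p' i; -p' i, 0]) 0 0
            (0 : Matrix (Fin l) (Fin l) ℤ) i j := by
      rcases hr with ⟨⟨a, i₀⟩ | i₀⟩
      · refine ⟨Sum.inl (0, i₀), fun i => if i = i₀ then -p i else p i, ?_⟩
        rintro (⟨a, i⟩ | i) (⟨c, j⟩ | j)
        · simp only [Matrix.fromBlocks_apply₁₁, Matrix.blockDiagonal_apply]
          by_cases hij : i = j
          · subst hij
            by_cases hi : i = i₀
            · subst hi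
              fin_cases a <;> fin_cases c <;> simp
            · simp [hi]
          · simp [hij]
        all_goals simp
      · refine ⟨Sum.inr i₀, p, ?_⟩
        rintro (⟨a, i⟩ | i) (⟨c, j⟩ | j) <;> simp
    refine ⟨k, l, p', U.updateRow (e i₀) (-U (e i₀)), e, ?_, ?_⟩
    · have := Matrix.det_updateRow_smul U (e i₀) (-1) (U (e i₀))
      rw [Matrix.updateRow_eq_self, neg_one_smul] at this
      rw [this, hdet]; rfl
    · have hrow : ∀ i, U.updateRow (e i₀) (-U (e i₀)) (e i) =
          (if i = i₀ then (-1 : ℤ) else 1) • b i := fun i => by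
        by_cases h : i = i₀
        · subst h; ext; simp [U]
        · ext; simp [U, h]
      ext i j
      rw [Matrix.submatrix_apply, hUL, hrow, hrow, ← hp', ← hb]
      simp only [map_smul, LinearMap.smul_apply, smul_eq_mul]
      ring

/-! ### Monomial basis and center of the quasi-Laurent algebra -/

namespace QuasiLaurent

variable {r : ℕ} (q : ℂ) (L : Matrix (Fin r) (Fin r) ℤ)

/-- The generator `z_i` as a unit. -/
noncomputable def gen (i : Fin r) : (QuasiLaurent q L)ˣ where
  val := RingQuot.mkAlgHom ℂ (QuasiLaurentRel q L) (FreeAlgebra.ι ℂ (Sum.inl i))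
  inv := RingQuot.mkAlgHom ℂ (QuasiLaurentRel q L) (FreeAlgebra.ι ℂ (Sum.inr i))
  val_inv := by
    rw [← map_mul, RingQuot.mkAlgHom_rel ℂ (QuasiLaurentRel.mul_inv i), map_one]
  inv_val := by
    rw [← map_mul, RingQuot.mkAlgHom_rel ℂ (QuasiLaurentRel.inv_mul i), map_one]

/-- Induction over the scalars, the generators and their inverses, products and sums. -/
theorem induction_on {P : QuasiLaurent q L → Prop} (x : QuasiLaurent q L)
    (halg : ∀ c : ℂ, P (algebraMap ℂ _ c)) (hgen : ∀ i, P (gen q L i))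
    (hinv : ∀ i, P ((gen q L i)⁻¹ : (QuasiLaurent q L)ˣ))
    (hmul : ∀ x y, P x → P y → P (x * y)) (hadd : ∀ x y, P x → P y → P (x + y)) : P x := by
  obtain ⟨x, rfl⟩ := RingQuot.mkAlgHom_surjective ℂ (QuasiLaurentRel q L) x
  induction x using FreeAlgebra.induction with
  | grade0 c => rw [AlgHom.commutes]; exact halg c
  | grade1 i => rcases i with i | i; exacts [hgen i, hinv i]
  | mul x y hx hy => rw [map_mul]; exact hmul _ _ hx hy
  | add x y hx hy => rw [map_add]; exact hadd _ _ hx hy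

variable {q L}

/-- The unit `q ^ n`. -/
noncomputable def scalar (hq : q ≠ 0) : (QuasiLaurent q L)ˣ :=
  Units.map (algebraMap ℂ (QuasiLaurent q L)).toMonoidHom (Units.mk0 q hq)

theorem scalar_zpow_coe (hq : q ≠ 0) (n : ℤ) :
    ((scalar (L := L) hq ^ n : (QuasiLaurent q L)ˣ) : QuasiLaurent q L) =
      algebraMap ℂ _ (q ^ n) := by
  have h : ((Units.mk0 q hq ^ n : ℂˣ) : ℂ) = q ^ n := by simp
  rw [scalar, ← map_zpow, ← h]
  rfl

theorem scalar_zpow_comm (hq : q ≠ 0) (n : ℤ) (u : (QuasiLaurent q L)ˣ) :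
    scalar hq ^ n * u = u * scalar hq ^ n := by
  ext
  rw [Units.val_mul, Units.val_mul, scalar_zpow_coe]
  exact Algebra.commutes _ _

theorem gen_mul_gen (hq : q ≠ 0) (hskew : ∀ i j, L j i = -L i j) (i j : Fin r) :
    gen q L i * gen q L j = scalar hq ^ L i j * (gen q L j * gen q L i) := by
  have key : ∀ i j, i < j →
      gen q L i * gen q L j = scalar hq ^ L i j * (gen q L j * gen q L i) := by
    intro i j h
    ext
    rw [Units.val_mul, Units.val_mul, Units.val_mul, scalar_zpow_coe, ← Algebra.smul_def]
    have := RingQuot.mkAlgHom_rel ℂ (QuasiLaurentRel.comm (q := q) (L := L) i j h)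
    rwa [map_mul, map_smul, map_mul] at this
  rcases lt_trichotomy i j with h | h | h
  · exact key i j h
  · subst h
    have : L i i = 0 := by have := hskew i i; omega
    simp [this]
  · rw [key j i h, hskew j i, ← mul_assoc, ← zpow_add]
    simp

theorem gen_mul_gen_zpow (hq : q ≠ 0) (hskew : ∀ i j, L j i = -L i j) (i j : Fin r) (n : ℤ) :
    gen q L i * gen q L j ^ n = scalar hq ^ (L i j * n) * (gen q L j ^ n * gen q L i) := by
  have h : SemiconjBy (gen q L i) (gen q L j) (scalar hq ^ L i j * gen q L j) := by
    rw [SemiconjBy, gen_mul_gen hq hskew, mul_assoc]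
  have h2 := h.zpow_right n
  rw [SemiconjBy, (show Commute _ _ from scalar_zpow_comm hq (L i j) (gen q L j)).mul_zpow,
    ← zpow_mul, mul_assoc] at h2
  exact h2

variable (q L) in
/-- The product of the powers `z_j ^ (a j)` over a list of indices. -/
noncomputable def listMonomial (l : List (Fin r)) (a : Fin r → ℤ) : (QuasiLaurent q L)ˣ :=
  (l.map fun j => gen q L j ^ a j).prod

theorem gen_mul_listMonomial (hq : q ≠ 0) (hskew : ∀ i j, L j i = -L i j) (i : Fin r)
    (l : List (Fin r)) (a : Fin r → ℤ) :
    gen q L i * listMonomial q L l a =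
      scalar hq ^ (l.map fun j => L i j * a j).sum * (listMonomial q L l a * gen q L i) := by
  induction l with
  | nil => simp [listMonomial]
  | cons j l ih =>
    have h1 : listMonomial q L (j :: l) a = gen q L j ^ a j * listMonomial q L l a := by
      simp [listMonomial]
    rw [h1, ← mul_assoc, gen_mul_gen_zpow hq hskew, mul_assoc, mul_assoc, ih, List.map_cons,
      List.sum_cons, zpow_add, ← mul_assoc (gen q L j ^ a j), ← scalar_zpow_comm]
    simp only [mul_assoc]

variable (q L) in
/-- The ordered monomial `z ^ a`. -/
noncomputable def monomial (a : Fin r → ℤ) : (QuasiLaurent q L)ˣ :=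
  listMonomial q L (List.finRange r) a

theorem monomial_zero : monomial q L 0 = 1 := by
  simp [monomial, listMonomial]

theorem gen_mul_monomial (hq : q ≠ 0) (hskew : ∀ i j, L j i = -L i j) (i : Fin r)
    (a : Fin r → ℤ) :
    gen q L i * monomial q L a = scalar hq ^ (L.mulVec a i) * (monomial q L a * gen q L i) := by
  rw [monomial, gen_mul_listMonomial hq hskew, Matrix.mulVec, dotProduct,
    ← Fin.sum_univ_def]

/-- Passing the factors that precede z_i costs only a power of q, and then the powers of z_i merge.
The exponents ±1 suffice, since the generators and their inverses generate the algebra. -/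
theorem exists_gen_zpow_mul_monomial (hq : q ≠ 0) (hskew : ∀ i j, L j i = -L i j) (i : Fin r)
    (n : ℤ) (hn : n = 1 ∨ n = -1) (a : Fin r → ℤ) :
    ∃ k : ℤ, gen q L i ^ n * monomial q L a =
      scalar hq ^ k * monomial q L (a + Pi.single i n) := by
  obtain ⟨l₁, l₂, hl⟩ := List.append_of_mem (List.mem_finRange i)
  have hnd := List.nodup_finRange r
  rw [hl, List.nodup_middle, List.nodup_cons, List.mem_append, not_or] at hnd
  have hsplit : ∀ a, monomial q L a =
      listMonomial q L l₁ a * (gen q L i ^ a i * listMonomial q L l₂ a) := fun a => by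
    simp [monomial, listMonomial, hl]
  have hcongr : ∀ l : List (Fin r), i ∉ l →
      listMonomial q L l (a + Pi.single i n) = listMonomial q L l a := fun l h => by
    unfold listMonomial
    congr 1
    refine List.map_congr_left fun j hj => ?_
    have : j ≠ i := fun e => h (e ▸ hj)
    simp [this]
  have hcomm : ∃ k : ℤ, gen q L i ^ n * listMonomial q L l₁ a =
      scalar hq ^ k * (listMonomial q L l₁ a * gen q L i ^ n) := by
    have h1 := gen_mul_listMonomial hq hskew i l₁ a
    set k := (l₁.map fun j => L i j * a j).sum
    rcases hn with rfl | rfl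
    · exact ⟨k, by simpa using h1⟩
    · refine ⟨-k, ?_⟩
      rw [zpow_neg_one, inv_mul_eq_iff_eq_mul, ← mul_assoc, ← scalar_zpow_comm, mul_assoc,
        ← mul_assoc (gen q L i), h1, mul_assoc, mul_assoc, mul_inv_cancel, mul_one, zpow_neg,
        inv_mul_cancel_left]
  obtain ⟨k, hk⟩ := hcomm
  refine ⟨k, ?_⟩
  rw [hsplit, hsplit, hcongr _ hnd.1.1, hcongr _ hnd.1.2, ← mul_assoc, hk, mul_assoc, mul_assoc,
    Pi.add_apply, Pi.single_eq_same, add_comm, zpow_add]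
  simp only [mul_assoc]

/-- The span is stable under left multiplication by generators and inverses, hence is a left ideal,
and it contains 1. -/
theorem span_monomial (hq : q ≠ 0) (hskew : ∀ i j, L j i = -L i j) :
    Submodule.span ℂ (Set.range fun a => (monomial q L a : QuasiLaurent q L)) = ⊤ := by
  set S := Submodule.span ℂ (Set.range fun a => (monomial q L a : QuasiLaurent q L)) with hS
  have hgen : ∀ i (n : ℤ), (n = 1 ∨ n = -1) → ∀ y ∈ S,
      ((gen q L i ^ n : (QuasiLaurent q L)ˣ) : QuasiLaurent q L) * y ∈ S := by
    intro i n hn y hy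
    induction hy using Submodule.span_induction with
    | mem y hy =>
      obtain ⟨a, rfl⟩ := hy
      obtain ⟨k, hk⟩ := exists_gen_zpow_mul_monomial hq hskew i n hn a
      dsimp only
      rw [← Units.val_mul, hk, Units.val_mul, scalar_zpow_coe, ← Algebra.smul_def]
      exact S.smul_mem _ (Submodule.subset_span ⟨_, rfl⟩)
    | zero => rw [mul_zero]; exact S.zero_mem
    | add x y _ _ hx hy => rw [mul_add]; exact S.add_mem hx hy
    | smul c x _ hx => rw [mul_smul_comm]; exact S.smul_mem _ hx
  have hall : ∀ x : QuasiLaurent q L, ∀ y ∈ S, x * y ∈ S := by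
    intro x
    induction x using induction_on with
    | halg c => intro y hy; rw [← Algebra.smul_def]; exact S.smul_mem _ hy
    | hgen i => intro y hy; simpa using hgen i 1 (Or.inl rfl) y hy
    | hinv i => intro y hy; simpa using hgen i (-1) (Or.inr rfl) y hy
    | hmul x y hx hy => intro z hz; rw [mul_assoc]; exact hx _ (hy _ hz)
    | hadd x y hx hy => intro z hz; rw [add_mul]; exact S.add_mem (hx _ hz) (hy _ hz)
  rw [eq_top_iff]
  intro x _
  have h1 : (1 : QuasiLaurent q L) ∈ S := by
    refine Submodule.subset_span ⟨0, ?_⟩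
    simp [monomial_zero]
  simpa using hall x 1 h1

/-- The exponent of `q` produced by `z_i` acting on `z ^ a`. -/
def shiftExponent (L : Matrix (Fin r) (Fin r) ℤ) (i : Fin r) (a : Fin r → ℤ) : ℤ :=
  ∑ j, if i < j then L i j * a j else 0

theorem shiftExponent_add (i : Fin r) (a b : Fin r → ℤ) :
    shiftExponent L i (a + b) = shiftExponent L i a + shiftExponent L i b := by
  simp only [shiftExponent, ← Finset.sum_add_distrib]
  refine Finset.sum_congr rfl fun j _ => ?_
  split_ifs <;> simp [mul_add]

theorem shiftExponent_single (i j : Fin r) (n : ℤ) :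
    shiftExponent L i (Pi.single j n) = if i < j then L i j * n else 0 := by
  rw [shiftExponent, Finset.sum_eq_single j]
  · simp
  · intro k _ hk; simp [hk]
  · simp

/-- The operators of `z_i` and of its inverse on the functions on the lattice. -/
noncomputable def shift (q : ℂ) (L : Matrix (Fin r) (Fin r) ℤ) :
    Fin r ⊕ Fin r → Module.End ℂ ((Fin r → ℤ) → ℂ)
  | Sum.inl i =>
    -- This is left multiplication by z_i on monomials in the decreasing order z_r^{a_r} ⋯
    -- z_1^{a_1}: z_i passes the z_j with j > i. The order is opposite to that of `monomial`, which
    -- is harmless because only the shift up to scalars is used.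
    { toFun := fun f a => q ^ shiftExponent L i (a - Pi.single i 1) * f (a - Pi.single i 1)
      map_add' := fun f g => by ext a; simp [mul_add]
      map_smul' := fun c f => by ext a; simp [mul_left_comm] }
  | Sum.inr i =>
    { toFun := fun f a => (q ^ shiftExponent L i a)⁻¹ * f (a + Pi.single i 1)
      map_add' := fun f g => by ext a; simp [mul_add]
      map_smul' := fun c f => by ext a; simp [mul_left_comm] }

/-- The representation of the quasi-Laurent algebra on the functions on the lattice. -/
noncomputable def shiftRep (hq : q ≠ 0) :
    QuasiLaurent q L →ₐ[ℂ] Module.End ℂ ((Fin r → ℤ) → ℂ) :=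
  RingQuot.liftAlgHom ℂ ⟨FreeAlgebra.lift ℂ (shift q L), by
    intro x y h
    have hz : ∀ n : ℤ, q ^ n ≠ 0 := fun n => zpow_ne_zero n hq
    cases h with
    | mul_inv i =>
      ext f a
      simp [shift, hz]
    | inv_mul i =>
      ext f a
      simp [shift, hz]
    | comm i j h =>
      ext f a
      simp only [map_mul, map_smul, FreeAlgebra.lift_ι_apply, shift, Module.End.mul_apply,
        LinearMap.coe_mk, AddHom.coe_mk, LinearMap.smul_apply, Pi.smul_apply, smul_eq_mul]
      rw [sub_right_comm]
      simp only [← mul_assoc, ← zpow_add₀ hq]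
      congr 2
      -- For i < j a step along e_j changes the exponent of z_i by L i j, while a step along e_i
      -- leaves that of z_j unchanged. The discrepancy is the commutation factor.
      have e1 : shiftExponent L i (a - Pi.single i 1) =
          shiftExponent L i (a - Pi.single j 1 - Pi.single i 1) +
            shiftExponent L i (Pi.single j 1) := by
        rw [← shiftExponent_add]; congr 1; abel
      have e2 : shiftExponent L j (a - Pi.single j 1) =
          shiftExponent L j (a - Pi.single j 1 - Pi.single i 1) +
            shiftExponent L j (Pi.single i 1) := by
        rw [← shiftExponent_add]; congr 1; abel
      rw [e1, e2, shiftExponent_single, shiftExponent_single, if_pos h, if_neg h.asymm]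
      ring⟩

theorem shiftRep_gen (hq : q ≠ 0) (i : Fin r) :
    shiftRep (L := L) hq (gen q L i) = shift q L (Sum.inl i) := by
  simp [shiftRep, gen]

/-- A unit which moves each point mass by the vector `a`, up to nonzero scalars. -/
def Shifts (hq : q ≠ 0) (u : (QuasiLaurent q L)ˣ) (a : Fin r → ℤ) : Prop :=
  ∀ b, ∃ s : ℂ, s ≠ 0 ∧ shiftRep hq (u : QuasiLaurent q L) (Pi.single b 1) = s • Pi.single (b + a) 1

theorem Shifts.one (hq : q ≠ 0) : Shifts (L := L) hq 1 0 := fun b => ⟨1, one_ne_zero, by simp⟩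

theorem Shifts.mul {hq : q ≠ 0} {u v : (QuasiLaurent q L)ˣ} {a b : Fin r → ℤ}
    (hu : Shifts hq u a) (hv : Shifts hq v b) : Shifts hq (u * v) (a + b) := fun c => by
  obtain ⟨s, hs, h1⟩ := hv c
  obtain ⟨t, ht, h2⟩ := hu (c + b)
  refine ⟨s * t, mul_ne_zero hs ht, ?_⟩
  rw [Units.val_mul, map_mul, Module.End.mul_apply, h1, map_smul, h2, smul_smul, add_assoc,
    add_comm b a]

theorem Shifts.inv {hq : q ≠ 0} {u : (QuasiLaurent q L)ˣ} {a : Fin r → ℤ}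
    (hu : Shifts hq u a) : Shifts hq u⁻¹ (-a) := fun c => by
  obtain ⟨s, hs, h1⟩ := hu (c + -a)
  refine ⟨s⁻¹, inv_ne_zero hs, ?_⟩
  rw [neg_add_cancel_right] at h1
  have h2 : (Pi.single c 1 : (Fin r → ℤ) → ℂ) =
      s⁻¹ • shiftRep hq (u : QuasiLaurent q L) (Pi.single (c + -a) 1) := by
    rw [h1, smul_smul, inv_mul_cancel₀ hs, one_smul]
  rw [h2, map_smul, ← Module.End.mul_apply, ← map_mul, Units.inv_mul, map_one,
    Module.End.one_apply]

theorem Shifts.zpow {hq : q ≠ 0} {u : (QuasiLaurent q L)ˣ} {a : Fin r → ℤ}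
    (hu : Shifts hq u a) (n : ℤ) : Shifts hq (u ^ n) (n • a) := by
  have hnat : ∀ n : ℕ, Shifts hq (u ^ n) (n • a) := fun n => by
    induction n with
    | zero => simpa using Shifts.one hq
    | succ n ih => rw [pow_succ, succ_nsmul]; exact ih.mul hu
  rcases Int.eq_nat_or_neg n with ⟨n, rfl | rfl⟩
  · simpa using hnat n
  · simpa using (hnat n).inv

theorem shifts_gen (hq : q ≠ 0) (i : Fin r) : Shifts hq (gen q L i) (Pi.single i 1) := fun b => by
  refine ⟨q ^ shiftExponent L i b, zpow_ne_zero _ hq, ?_⟩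
  rw [shiftRep_gen]
  ext a
  by_cases h : a = b + Pi.single i 1
  · subst h; simp [shift]
  · have h' : a - Pi.single i 1 ≠ b := fun e => h (by rw [← e, sub_add_cancel])
    simp [shift, h, h']

theorem shifts_monomial (hq : q ≠ 0) (a : Fin r → ℤ) : Shifts hq (monomial q L a) a := by
  have h : ∀ l : List (Fin r), Shifts hq (listMonomial q L l a)
      (l.map fun i => (Pi.single i (a i) : Fin r → ℤ)).sum := fun l => by
    induction l with
    | nil => simpa [listMonomial] using Shifts.one hq
    | cons i l ih =>
      have h1 := (shifts_gen (L := L) hq i).zpow (a i)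
      have h2 : a i • (Pi.single i 1 : Fin r → ℤ) = Pi.single i (a i) := by
        rw [← Pi.single_smul]; simp
      rw [h2] at h1
      simpa [listMonomial] using h1.mul ih
  have := h (List.finRange r)
  rwa [← Fin.sum_univ_def, Finset.univ_sum_single] at this

/-- Applied to the point mass at 0, the monomials give nonzero multiples of distinct point masses.
-/
theorem linearIndependent_monomial (hq : q ≠ 0) :
    LinearIndependent ℂ fun a => (monomial q L a : QuasiLaurent q L) := by
  let ev : QuasiLaurent q L →ₗ[ℂ] ((Fin r → ℤ) → ℂ) :=
    (LinearMap.applyₗ (Pi.single 0 1)).comp (shiftRep (L := L) hq).toLinearMap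
  refine LinearIndependent.of_comp ev ?_
  choose s hs h using fun a => shifts_monomial (L := L) hq a 0
  have h1 : (ev ∘ fun a => (monomial q L a : QuasiLaurent q L)) =
      fun a => s a • (Pi.single a 1 : (Fin r → ℤ) → ℂ) := by
    ext1 a
    have := h a
    rw [zero_add] at this
    exact this
  rw [h1]
  exact (Pi.linearIndependent_single_one (Fin r → ℤ) ℂ).units_smul (fun a => Units.mk0 (s a) (hs a))

/-- The monomials form a basis. -/
noncomputable def monomialBasis (hq : q ≠ 0) (hskew : ∀ i j, L j i = -L i j) :
    Module.Basis (Fin r → ℤ) ℂ (QuasiLaurent q L) :=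
  Module.Basis.mk (linearIndependent_monomial hq) (span_monomial hq hskew).ge

theorem mem_center_of_gen {x : QuasiLaurent q L}
    (h : ∀ i, (gen q L i : QuasiLaurent q L) * x = x * gen q L i) :
    x ∈ Subalgebra.center ℂ (QuasiLaurent q L) := by
  rw [Subalgebra.mem_center_iff]
  intro y
  induction y using induction_on with
  | halg c => exact Algebra.commutes _ _
  | hgen i => exact h i
  | hinv i =>
    exact (Commute.units_inv_left (show Commute (gen q L i : QuasiLaurent q L) x from h i)).eq
  | hmul y z hy hz => rw [mul_assoc, hz, ← mul_assoc, hy, mul_assoc]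
  | hadd y z hy hz => rw [add_mul, mul_add, hy, hz]

theorem zpow_eq_one_imp (hroot : ∀ n : ℕ, 0 < n → q ^ n ≠ 1) (n : ℤ)
    (h : q ^ n = 1) : n = 0 := by
  rcases Int.eq_nat_or_neg n with ⟨n, rfl | rfl⟩
  · rw [zpow_natCast] at h
    by_contra hn
    exact hroot n (by omega) h
  · rw [zpow_neg, zpow_natCast, inv_eq_one] at h
    by_contra hn
    exact hroot n (by omega) h

/-- For `q` not a root of unity, the center of the quasi-Laurent algebra of a skew-symmetric matrix
is trivial if and only if the matrix is nonsingular. -/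
theorem center_eq_bot_iff (hq : q ≠ 0) (hroot : ∀ n : ℕ, 0 < n → q ^ n ≠ 1)
    (hskew : ∀ i j, L j i = -L i j) :
    Subalgebra.center ℂ (QuasiLaurent q L) = ⊥ ↔ L.det ≠ 0 := by
  let b := monomialBasis (q := q) hq hskew
  have hb : ∀ a, b a = monomial q L a := fun a => by simp [b, monomialBasis]
  have hone : b 0 = 1 := by rw [hb, monomial_zero, Units.val_one]
  have hgb : ∀ i a, (gen q L i : QuasiLaurent q L) * b a = q ^ (L.mulVec a i) • (b a * gen q L i) :=
    fun i a => by
      rw [hb, ← Units.val_mul, gen_mul_monomial hq hskew, Units.val_mul, Units.val_mul,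
        scalar_zpow_coe, Algebra.smul_def]
  constructor
  · intro hc hdet
    -- An integral kernel vector a ≠ 0 gives a central monomial z^a that is not a scalar.
    obtain ⟨a, ha, hLa⟩ := Matrix.exists_mulVec_eq_zero_iff.2 hdet
    have hmem : b a ∈ Subalgebra.center ℂ (QuasiLaurent q L) := mem_center_of_gen fun i => by
      rw [hgb, hLa]; simp
    rw [hc, Algebra.mem_bot] at hmem
    obtain ⟨c, hc⟩ := hmem
    rw [Algebra.algebraMap_eq_smul_one, ← hone] at hc
    have h1 := congrArg (fun x => b.repr x a) hc
    simp [ha.symm] at h1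
  · intro hdet
    rw [eq_bot_iff]
    intro x hx
    rw [Subalgebra.mem_center_iff] at hx
    have hcoef : ∀ a, b.repr x a ≠ 0 → a = 0 := by
      intro a ha
      by_contra ha0
      refine hdet (Matrix.exists_mulVec_eq_zero_iff.1 ⟨a, ha0, ?_⟩)
      ext i
      rw [Pi.zero_apply]
      refine zpow_eq_one_imp hroot _ ?_
      -- Conjugation by z_i fixes the central x and multiplies the basis vector z^a by q^{(La)_i}. A
      -- nonzero coefficient at a therefore forces this power to be 1, so (La)_i = 0.
      let T : QuasiLaurent q L →ₗ[ℂ] QuasiLaurent q L :=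
        (LinearMap.mulLeft ℂ (gen q L i : QuasiLaurent q L)).comp
          (LinearMap.mulRight ℂ (((gen q L i)⁻¹ : (QuasiLaurent q L)ˣ) : QuasiLaurent q L))
      have hT : ∀ y, T y = gen q L i * (y * ((gen q L i)⁻¹ : (QuasiLaurent q L)ˣ)) := fun y => rfl
      have hTb : ∀ a, T (b a) = q ^ (L.mulVec a i) • b a := fun a => by
        rw [hT, ← mul_assoc, hgb, smul_mul_assoc, mul_assoc, Units.mul_inv, mul_one]
      have hTx : T x = x := by
        rw [hT, ← mul_assoc, hx, mul_assoc, Units.mul_inv, mul_one]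
      have hrepr : ∀ y, b.repr (T y) a = q ^ (L.mulVec a i) * b.repr y a := by
        intro y
        have : (b.coord a).comp T = q ^ (L.mulVec a i) • b.coord a := by
          refine b.ext fun c => ?_
          rw [LinearMap.comp_apply, hTb]
          by_cases hca : c = a
          · subst hca; simp
          · simp [hca]
        exact LinearMap.congr_fun this y
      have := hrepr x
      rw [hTx] at this
      exact (mul_right_cancel₀ ha (by rw [one_mul]; exact this)).symm
    have hrep : b.repr x = Finsupp.single 0 (b.repr x 0) := by
      ext a
      by_cases ha : a = 0
      · subst ha; simp
      · rw [Finsupp.single_apply, if_neg (Ne.symm ha)]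
        by_contra h
        exact ha (hcoef a h)
    rw [Algebra.mem_bot]
    refine ⟨b.repr x 0, ?_⟩
    rw [Algebra.algebraMap_eq_smul_one, ← hone]
    apply b.repr.injective
    rw [map_smul, b.repr_self, hrep]
    simp

end QuasiLaurent

/-! ### Invariant form, telescoping root sums and exchange vectors -/

namespace CartanDatum

variable {ι : Type*} [Fintype ι] [DecidableEq ι] (C : CartanDatum ι)

/-- The Gram matrix of the simple roots. -/
def gram : Matrix ι ι ℝ := (Matrix.diagonal C.d * C.A).map (fun z : ℤ => (z : ℝ))

theorem gram_apply (i j : ι) : C.gram i j = (C.d i : ℝ) * C.A i j := by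
  simp [gram]

theorem gram_symm (i j : ι) : C.gram i j = C.gram j i := by
  rw [gram_apply, gram_apply]
  exact_mod_cast C.symm i j

/-- The invariant form on the real root space as a bilinear map. -/
noncomputable def formB : (ι → ℝ) →ₗ[ℝ] (ι → ℝ) →ₗ[ℝ] ℝ := Matrix.toLinearMap₂' ℝ C.gram

theorem form_eq_formB (x y : ι → ℝ) : C.form ℝ x y = C.formB x y := by
  rw [formB, Matrix.toLinearMap₂'_apply, form]
  refine Finset.sum_congr rfl fun i _ => Finset.sum_congr rfl fun j _ => ?_
  rw [gram_apply]
  push_cast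
  simp only [smul_eq_mul]
  ring

theorem formB_comm (x y : ι → ℝ) : C.formB x y = C.formB y x := by
  rw [formB, Matrix.toLinearMap₂'_apply, Matrix.toLinearMap₂'_apply, Finset.sum_comm]
  refine Finset.sum_congr rfl fun i _ => Finset.sum_congr rfl fun j _ => ?_
  rw [gram_symm]
  simp only [smul_eq_mul]
  ring

/-- The value of the simple coroot `i` at `x`. -/
def corootVal (i : ι) (x : ι → ℝ) : ℝ := ∑ j, (C.A i j : ℝ) * x j

theorem corootVal_single (i j : ι) : C.corootVal i (Pi.single j 1) = C.A i j := by
  simp [corootVal, Pi.single_apply]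

theorem formB_single_left (i : ι) (x : ι → ℝ) :
    C.formB (Pi.single i 1) x = C.d i * C.corootVal i x := by
  rw [formB, Matrix.toLinearMap₂'_apply', single_one_dotProduct, Matrix.mulVec, dotProduct,
    corootVal, Finset.mul_sum]
  exact Finset.sum_congr rfl fun j _ => by rw [gram_apply, mul_assoc]

theorem simpleReflection_apply (i : ι) (x : ι → ℝ) :
    C.simpleReflection ℝ i x = x - C.corootVal i x • Pi.single i 1 := rfl

theorem formB_simpleReflection (i : ι) (x y : ι → ℝ) :
    C.formB (C.simpleReflection ℝ i x) (C.simpleReflection ℝ i y) = C.formB x y := by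
  rw [simpleReflection_apply, simpleReflection_apply]
  simp only [map_sub, map_smul, LinearMap.sub_apply, LinearMap.smul_apply, smul_eq_mul]
  rw [C.formB_comm x (Pi.single i 1), formB_single_left, formB_single_left, formB_single_left,
    corootVal_single, C.diag]
  push_cast
  ring

theorem formB_weylElt (w : List ι) (x y : ι → ℝ) :
    C.formB (C.weylElt ℝ w x) (C.weylElt ℝ w y) = C.formB x y := by
  induction w with
  | nil => simp [weylElt]
  | cons i w ih =>
    have h : ∀ x, C.weylElt ℝ (i :: w) x = C.simpleReflection ℝ i (C.weylElt ℝ w x) := fun x => by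
      simp [weylElt]
    rw [h, h, formB_simpleReflection, ih]

theorem formB_fundWeight (x : ι → ℝ) (s : ι) : C.formB x (C.fundWeight s) = C.d s * x s := by
  have hdet : IsUnit C.gram.det := C.posDef.isUnit.map Matrix.detMonoidHom
  rw [formB, Matrix.toLinearMap₂'_apply', fundWeight]
  change x ⬝ᵥ C.gram.mulVec (C.gram⁻¹.mulVec _) = _
  rw [Matrix.mulVec_mulVec, Matrix.mul_nonsing_inv _ hdet, Matrix.one_mulVec,
    dotProduct_single, mul_comm]

theorem corootVal_fundWeight (i s : ι) :
    C.corootVal i (C.fundWeight s) = if i = s then 1 else 0 := by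
  have h := C.formB_single_left i (C.fundWeight s)
  rw [formB_fundWeight] at h
  have hd : (C.d i : ℝ) ≠ 0 := by exact_mod_cast (C.d_pos i).ne'
  by_cases his : i = s
  · subst his
    rw [Pi.single_eq_same] at h
    rw [if_pos rfl]
    exact (mul_left_cancel₀ hd h).symm
  · rw [Pi.single_eq_of_ne (Ne.symm his), mul_zero] at h
    rw [if_neg his]
    exact (mul_eq_zero.1 h.symm).resolve_left hd

theorem weylElt_cast (w : List ι) (x : ι → ℤ) :
    C.weylElt ℝ w (fun i => (x i : ℝ)) = fun i => ((C.weylElt ℤ w x i : ℤ) : ℝ) := by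
  induction w with
  | nil => simp [weylElt]
  | cons i w ih =>
    have h : C.weylElt ℝ (i :: w) (fun i => (x i : ℝ)) =
        C.simpleReflection ℝ i (C.weylElt ℝ w (fun i => (x i : ℝ))) := by simp [weylElt]
    have h' : C.weylElt ℤ (i :: w) x = C.simpleReflection ℤ i (C.weylElt ℤ w x) := by
      simp [weylElt]
    rw [h, h', ih]
    ext j
    simp [simpleReflection, Pi.single_apply]

variable (w : List ι)

/-- The root `β_n` in the real root space. -/
def realRoot (n : Fin w.length) : ι → ℝ := C.weylElt ℝ (w.take n) (Pi.single (w.get n) 1)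

theorem realRoot_eq (n : Fin w.length) : C.realRoot w n = fun i => (C.root w n i : ℝ) := by
  rw [realRoot, root, ← weylElt_cast]
  congr 1
  ext i
  simp [Pi.single_apply]

theorem formB_realRoot (m n : Fin w.length) :
    C.formB (C.realRoot w m) (C.realRoot w n) = (C.form ℤ (C.root w m) (C.root w n) : ℤ) := by
  rw [← form_eq_formB, realRoot_eq, realRoot_eq, form, form]
  push_cast
  rfl

theorem formB_realRoot_self (n : Fin w.length) :
    C.formB (C.realRoot w n) (C.realRoot w n) = 2 * C.d (w.get n) := by
  rw [realRoot, formB_weylElt, formB_single_left, corootVal_single, C.diag]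
  push_cast
  ring

/-- The sum of the roots `β_k`, `k < p`, weighted by the values of the simple coroots, measures the
displacement of a vector by the initial part of the word. -/
theorem sum_corootVal_smul_realRoot (x : ι → ℝ) (p : ℕ) (hp : p ≤ w.length) :
    ∑ k : Fin w.length, (if (k : ℕ) < p then C.corootVal (w.get k) x else 0) • C.realRoot w k =
      x - C.weylElt ℝ (w.take p) x := by
  induction p with
  | zero => simp [weylElt]
  | succ p ih =>
    -- One more letter i turns ω x into ω(x - ⟨x, α_i^∨⟩ α_i), where ω α_i is the next root.
    have hstep : C.weylElt ℝ (w.take (p + 1)) x =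
        C.weylElt ℝ (w.take p) x - C.corootVal (w.get ⟨p, hp⟩) x • C.realRoot w ⟨p, hp⟩ := by
      have : w.take (p + 1) = w.take p ++ [w.get ⟨p, hp⟩] := by
        rw [List.take_succ_eq_append_getElem hp]; rfl
      rw [this, weylElt, List.map_append, List.prod_append, List.map_singleton,
        List.prod_singleton, Module.End.mul_apply, simpleReflection_apply, map_sub, map_smul]
      rfl
    rw [hstep, sub_sub_eq_add_sub, add_sub_right_comm, ← ih (by omega)]
    have hsplit : ∀ k : Fin w.length,
        (if (k : ℕ) < p + 1 then C.corootVal (w.get k) x else 0) • C.realRoot w k =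
          (if (k : ℕ) < p then C.corootVal (w.get k) x else 0) • C.realRoot w k +
            if k = ⟨p, hp⟩ then C.corootVal (w.get k) x • C.realRoot w k else 0 := fun k => by
      by_cases h : k = ⟨p, hp⟩
      · subst h; simp
      · have h' : (k : ℕ) ≠ p := fun e => h (Fin.ext e)
        have h'' : (k : ℕ) < p + 1 ↔ (k : ℕ) < p := by omega
        simp [h, h'']
    simp only [hsplit, Finset.sum_add_distrib, Finset.sum_ite_eq', Finset.mem_univ, if_true]

/-- The simple coroots take the values 0 and 1 on Λ_s, so only the letter s survives in the
displacement formula. For p one past a position m of letter s, the sum runs over the roots of the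
factors of M_m. -/
theorem sum_realRoot_letter (s : ι) (p : ℕ) (hp : p ≤ w.length) :
    ∑ k : Fin w.length, (if (k : ℕ) < p ∧ w.get k = s then (1 : ℝ) else 0) • C.realRoot w k =
      C.fundWeight s - C.weylElt ℝ (w.take p) (C.fundWeight s) := by
  rw [← sum_corootVal_smul_realRoot C w _ p hp]
  refine Finset.sum_congr rfl fun k _ => ?_
  rw [corootVal_fundWeight, ite_and]

/-- `(ω_{n-1} x, β_n)`. -/
theorem formB_realRoot_weylElt (n : Fin w.length) (x : ι → ℝ) :
    C.formB (C.realRoot w n) (C.weylElt ℝ (w.take n) x) = C.d (w.get n) * C.corootVal (w.get n) x := by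
  rw [realRoot, formB_weylElt, formB_single_left]

/-- The image `ω_m Λ_{i_m}`. -/
noncomputable def extremalWeight (m : Fin w.length) : ι → ℝ :=
  C.weylElt ℝ (w.take (m + 1)) (C.fundWeight (w.get m))

theorem formL₀_cast (m n : Fin w.length) : (C.formL₀ w m n : ℝ) =
    if m < n then C.formB (C.realRoot w m) (C.realRoot w n)
    else if n < m then -C.formB (C.realRoot w m) (C.realRoot w n) else 0 := by
  simp only [formB_realRoot, formL₀, Matrix.of_apply]
  split_ifs <;> simp

/-- For k > m all roots of M_m precede β_k and the telescoping sum applies directly. For k ≤ m the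
signs of the roots after β_k are reversed; the contributions from the two sides of k cancel except
for (β_k, Λ + ξ). -/
theorem minorExponents_mul_formL₀ (m k : Fin w.length) :
    ((minorExponents w * C.formL₀ w) m k : ℝ) =
      C.formB (C.realRoot w k) (C.fundWeight (w.get m) - C.extremalWeight w m) +
        if k ≤ m then 2 * C.formB (C.realRoot w k) (C.extremalWeight w m) else 0 := by
  set s := w.get m with hs
  have hsum : ((minorExponents w * C.formL₀ w) m k : ℝ) =
      ∑ j : Fin w.length, (if (j : ℕ) < m + 1 ∧ w.get j = s then (1 : ℝ) else 0) *
        (C.formL₀ w j k : ℝ) := by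
    rw [Matrix.mul_apply]
    push_cast
    refine Finset.sum_congr rfl fun j _ => ?_
    have : (j : ℕ) < m + 1 ↔ j ≤ m := by rw [Fin.le_def]; omega
    simp only [minorExponents, Matrix.of_apply, this, ← hs]
    push_cast
    rfl
  have hW : ∀ p ≤ w.length, ∑ j : Fin w.length,
      (if (j : ℕ) < p ∧ w.get j = s then (1 : ℝ) else 0) *
        C.formB (C.realRoot w j) (C.realRoot w k) =
      C.formB (C.realRoot w k) (C.fundWeight s - C.weylElt ℝ (w.take p) (C.fundWeight s)) :=
    fun p hp => by
      rw [← sum_realRoot_letter C w s p hp, map_sum]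
      refine Finset.sum_congr rfl fun j _ => ?_
      rw [map_smul, smul_eq_mul, formB_comm]
  have hm := hW (m + 1) m.2
  rw [hsum]
  by_cases hkm : k ≤ m
  · have hk := hW k k.2.le
    -- The sign of k - j is written as 2[j < k] + [j = k] - 1, so that the first and last parts
    -- telescope. The diagonal correction is (β_k, β_k) = 2d.
    have hpt : ∀ j : Fin w.length, (if (j : ℕ) < m + 1 ∧ w.get j = s then (1 : ℝ) else 0) *
        (C.formL₀ w j k : ℝ) =
        2 * ((if (j : ℕ) < k ∧ w.get j = s then (1 : ℝ) else 0) *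
            C.formB (C.realRoot w j) (C.realRoot w k)) +
          (if j = k then (if w.get j = s then 2 * (C.d (w.get j) : ℝ) else 0) else 0) -
          (if (j : ℕ) < m + 1 ∧ w.get j = s then (1 : ℝ) else 0) *
            C.formB (C.realRoot w j) (C.realRoot w k) := fun j => by
      rw [formL₀_cast]
      by_cases hj : w.get j = s
      · simp only [hj, and_true, if_true]
        rcases lt_trichotomy j k with h | h | h
        · have h1 : (j : ℕ) < m + 1 := by rw [Fin.le_def] at hkm; rw [Fin.lt_def] at h; omega
          have h2 : (j : ℕ) < k := h
          simp only [h, h1, h2, h.ne, if_true, if_false]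
          ring
        · subst h
          have h1 : (j : ℕ) < m + 1 := by rw [Fin.le_def] at hkm; omega
          simp only [h1, lt_irrefl, if_true, if_false, formB_realRoot_self, hj]
          ring
        · have h2 : ¬ (j : ℕ) < k := not_lt.2 h.le
          simp [h, h.asymm, h2, h.ne']
      · simp only [hj, and_false, if_false]
        simp
    simp only [hpt, Finset.sum_add_distrib, Finset.sum_sub_distrib, ← Finset.mul_sum, hk, hm,
      Finset.sum_ite_eq', Finset.mem_univ, if_true, if_pos hkm, map_sub]
    -- The value (β_k, ω_{k-1} Λ_s), which is d if k has the letter s and 0 otherwise, cancels the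
    -- diagonal correction.
    rw [formB_realRoot_weylElt, corootVal_fundWeight, extremalWeight, ← hs]
    split_ifs <;> ring
  · have hlt : m < k := not_le.1 hkm
    rw [if_neg hkm, add_zero, extremalWeight, ← hs, ← hm]
    refine Finset.sum_congr rfl fun j _ => ?_
    by_cases h : (j : ℕ) < m + 1 ∧ w.get j = s
    · have : j < k := by
        have := h.1
        rw [Fin.lt_def] at hlt ⊢; omega
      rw [formL₀_cast, if_pos this]
    · rw [if_neg h, zero_mul, zero_mul]

/-- The vector `e_p + ∑ A_{i_k, i_p} e_k`, the sum over `k < p`. -/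
def exchangeVec (p k : Fin w.length) : ℤ :=
  if k < p then C.A (w.get k) (w.get p) else if k = p then 1 else 0

/-- The exchange vector is the expansion of α_{i_p} in the roots up to β_p. The part of the pairing
that is cut off at m is again a displacement of α_{i_p}. If m < p it produces (ω_m α_{i_p}, ω_m
Λ_{i_m}), which by invariance is d for equal letters and 0 otherwise. -/
theorem sum_mul_exchangeVec (m p : Fin w.length) :
    (∑ k, ((minorExponents w * C.formL₀ w) m k : ℝ) * C.exchangeVec w p k) =
      C.formB (Pi.single (w.get p) 1) (C.fundWeight (w.get m) + C.extremalWeight w m) -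
        if m < p ∧ w.get m = w.get p then 2 * (C.d (w.get p) : ℝ) else 0 := by
  set α : ι → ℝ := Pi.single (w.get p) 1 with hα
  set Λ := C.fundWeight (w.get m)
  set ξ := C.extremalWeight w m with hξ
  have hW : ∀ q ≤ w.length, ∀ y, ∑ k : Fin w.length,
      (if (k : ℕ) < q then (C.A (w.get k) (w.get p) : ℝ) else 0) * C.formB (C.realRoot w k) y =
      C.formB (α - C.weylElt ℝ (w.take q) α) y := fun q hq y => by
    rw [← sum_corootVal_smul_realRoot C w α q hq, map_sum, LinearMap.sum_apply]
    refine Finset.sum_congr rfl fun k _ => ?_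
    rw [map_smul, LinearMap.smul_apply, smul_eq_mul, hα, corootVal_single]
  -- The conditions k < p and k ≤ m combine to an initial segment of length min(p, m + 1), positions
  -- being counted from 0. The entry k = p is kept apart.
  have hpt : ∀ k, ((minorExponents w * C.formL₀ w) m k : ℝ) * C.exchangeVec w p k =
      (if (k : ℕ) < p then (C.A (w.get k) (w.get p) : ℝ) else 0) *
          C.formB (C.realRoot w k) (Λ - ξ) +
        2 * ((if (k : ℕ) < min (p : ℕ) (m + 1) then (C.A (w.get k) (w.get p) : ℝ) else 0) *
          C.formB (C.realRoot w k) ξ) +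
        if k = p then ((minorExponents w * C.formL₀ w) m k : ℝ) else 0 := fun k => by
    by_cases h : k < p
    · have h' : (k : ℕ) < p := h
      have h1 : (k : ℕ) < min (p : ℕ) (m + 1) ↔ k ≤ m := by rw [Fin.le_def]; omega
      rw [minorExponents_mul_formL₀, exchangeVec]
      simp only [h, h', h.ne, h1, if_true, if_false]
      split_ifs <;> ring
    · have h' : ¬ (k : ℕ) < p := h
      have h1 : ¬ (k : ℕ) < min (p : ℕ) (m + 1) := by omega
      simp only [exchangeVec, h, h', h1, if_false]
      by_cases hkp : k = p <;> simp [hkp]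
  simp only [hpt, Finset.sum_add_distrib, ← Finset.mul_sum, Finset.sum_ite_eq', Finset.mem_univ,
    if_true]
  rw [hW _ p.2.le, hW _ (by omega), minorExponents_mul_formL₀]
  have hβ : C.weylElt ℝ (w.take p) α = C.realRoot w p := rfl
  by_cases h : p ≤ m
  · have h1 : min (p : ℕ) (m + 1) = p := by rw [Fin.le_def] at h; omega
    rw [h1, hβ, if_pos h, if_neg (fun e => absurd e.1 (not_lt.2 h))]
    simp only [map_sub, map_add, LinearMap.sub_apply]
    ring
  · have hlt := not_le.1 h
    have h1 : min (p : ℕ) (m + 1) = m + 1 := by rw [Fin.lt_def] at hlt; omega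
    have h2 : C.formB (C.weylElt ℝ (w.take (m + 1)) α) ξ =
        if w.get m = w.get p then (C.d (w.get p) : ℝ) else 0 := by
      rw [hξ, extremalWeight, formB_weylElt, formB_fundWeight, hα, Pi.single_apply]
      split_ifs with h3
      · rw [h3]; simp
      · simp
    rw [h1, hβ, if_neg h]
    simp only [hlt, true_and, map_sub, map_add, LinearMap.sub_apply, h2]
    split_ifs <;> ring

end CartanDatum

/-! ### Occurrences of a letter and the cyclic successor -/

section Letters

variable {ι : Type*} [DecidableEq ι] (w : List ι)

theorem det_minorExponents : (minorExponents w).det = 1 := by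
  rw [Matrix.det_of_isLowerTriangular]
  · simp [minorExponents]
  · intro i j hij
    have : i < j := hij
    simp [minorExponents, not_le.2 this]

/-- The first position with the same letter. -/
def firstPos (n : Fin w.length) : Fin w.length :=
  ⟨w.idxOf (w.get n), List.idxOf_lt_length_of_mem (List.get_mem w n)⟩

theorem get_firstPos (n : Fin w.length) : w.get (firstPos w n) = w.get n := by
  simp [firstPos]

theorem firstPos_le {m n : Fin w.length} (h : w.get m = w.get n) : firstPos w n ≤ m := by
  by_contra hlt
  have h1 : (m : ℕ) < w.findIdx (· == w.get n) := not_le.1 hlt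
  have h2 := List.not_of_lt_findIdx h1
  exact absurd h (by simpa using h2)

/-- The cyclic successor of a position among those with the same letter. -/
def letterSucc (n : Fin w.length) : Fin w.length :=
  if h : IsRepeated w n then
    (Finset.univ.filter fun m => n < m ∧ w.get m = w.get n).min'
      (h.imp fun m hm => Finset.mem_filter.2 ⟨Finset.mem_univ m, hm⟩)
  else firstPos w n

theorem letterSucc_mem {n : Fin w.length} (h : IsRepeated w n) :
    n < letterSucc w n ∧ w.get (letterSucc w n) = w.get n := by
  rw [letterSucc, dif_pos h]
  have := Finset.min'_mem (Finset.univ.filter fun m => n < m ∧ w.get m = w.get n)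
    (h.imp fun m hm => Finset.mem_filter.2 ⟨Finset.mem_univ m, hm⟩)
  exact (Finset.mem_filter.1 this).2

theorem letterSucc_le {n m : Fin w.length} (h : IsRepeated w n) (hlt : n < m)
    (hm : w.get m = w.get n) : letterSucc w n ≤ m := by
  rw [letterSucc, dif_pos h]
  exact Finset.min'_le _ _ (Finset.mem_filter.2 ⟨Finset.mem_univ m, hlt, hm⟩)

theorem letterSucc_of_not {n : Fin w.length} (h : ¬ IsRepeated w n) :
    letterSucc w n = firstPos w n := by
  rw [letterSucc, dif_neg h]

theorem get_letterSucc (n : Fin w.length) : w.get (letterSucc w n) = w.get n := by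
  by_cases h : IsRepeated w n
  · exact (letterSucc_mem w h).2
  · rw [letterSucc_of_not w h, get_firstPos]

/-- This makes the successor a permutation of the positions, the one that triangularizes the
reducing columns. For m < n with one letter, the successor of m lies in (m, n], while that of n lies
after n or, by wrapping around, at or before m. -/
theorem letterSucc_injective : Function.Injective (letterSucc w) := by
  intro m n h
  have hl : w.get m = w.get n := by rw [← get_letterSucc w m, h, get_letterSucc]
  by_contra hne
  wlog hlt : m < n generalizing m n
  · exact this h.symm hl.symm (Ne.symm hne) (lt_of_le_of_ne (not_lt.1 hlt) (Ne.symm hne))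
  have hm : IsRepeated w m := ⟨n, hlt, hl.symm⟩
  have h1 := letterSucc_le w hm hlt hl.symm
  by_cases hn : IsRepeated w n
  · have h2 := (letterSucc_mem w hn).1
    rw [← h] at h2
    exact absurd h1 (not_le.2 h2)
  · rw [letterSucc_of_not w hn] at h
    have h2 := (letterSucc_mem w hm).1
    rw [h] at h2
    exact absurd (firstPos_le w hl) (not_le.2 h2)

/-- Each letter has exactly one last occurrence. -/
theorem card_last : Fintype.card (Last w) = w.toFinset.card := by
  rw [← Fintype.card_coe]
  refine Fintype.card_of_bijective
    (f := fun n => ⟨w.get n.1, List.mem_toFinset.2 (List.get_mem w n.1)⟩) ⟨?_, ?_⟩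
  · rintro ⟨m, hm⟩ ⟨n, hn⟩ h
    have hl : w.get m = w.get n := congrArg Subtype.val h
    rcases lt_trichotomy m n with h1 | h1 | h1
    · exact absurd ⟨n, h1, hl.symm⟩ hm
    · exact Subtype.ext h1
    · exact absurd ⟨m, h1, hl⟩ hn
  · rintro ⟨s, hs⟩
    obtain ⟨k, hk⟩ := List.get_of_mem (List.mem_toFinset.1 hs)
    have hne : (Finset.univ.filter fun m => w.get m = s).Nonempty := ⟨k, by simpa using hk⟩
    have hmem := (Finset.mem_filter.1 (Finset.max'_mem _ hne)).2
    refine ⟨⟨Finset.max' _ hne, ?_⟩, Subtype.ext hmem⟩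
    rintro ⟨m, h1, h2⟩
    exact absurd (Finset.le_max' _ m (Finset.mem_filter.2 ⟨Finset.mem_univ m, h2.trans hmem⟩))
      (not_le.2 h1)

theorem card_nonLast : Fintype.card (NonLast w) = w.length - w.toFinset.card := by
  have h := Fintype.card_congr (Equiv.sumCompl (IsRepeated w))
  rw [Fintype.card_sum, Fintype.card_fin] at h
  have h2 := card_last w
  change Fintype.card (NonLast w) + Fintype.card (Last w) = _ at h
  omega

end Letters

/-- Sylvester's identity after factoring out 2. The sizes may differ, so the determinants agree only
up to a power of 2. It carries 1 + ω from the root space to the positions of the word. -/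
theorem Matrix.det_two_sub_mul_ne_zero_comm {m n : Type*} [Fintype m] [Fintype n] [DecidableEq m]
    [DecidableEq n] (X : Matrix m n ℝ) (Y : Matrix n m ℝ) :
    (2 - X * Y).det ≠ 0 ↔ (2 - Y * X).det ≠ 0 := by
  have h1 : 2 - X * Y = (2 : ℝ) • (1 - X * ((1 / 2 : ℝ) • Y)) := by
    rw [smul_sub, Matrix.mul_smul, smul_smul, ← one_add_one_eq_two (R := Matrix m m ℝ), two_smul]
    norm_num
  have h2 : 2 - Y * X = (2 : ℝ) • (1 - ((1 / 2 : ℝ) • Y) * X) := by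
    rw [smul_sub, Matrix.smul_mul, smul_smul, ← one_add_one_eq_two (R := Matrix n n ℝ), two_smul]
    norm_num
  rw [h1, h2, Matrix.det_smul, Matrix.det_smul, Matrix.det_one_sub_mul_comm]
  simp

/-! ### Column reduction of the skew form -/

namespace CartanDatum

variable {ι : Type*} [Fintype ι] [DecidableEq ι] (C : CartanDatum ι) (w : List ι)

theorem formL₀_skew (i j : Fin w.length) : C.formL₀ w j i = -C.formL₀ w i j := by
  have hcomm : ∀ x y : ι → ℤ, C.form ℤ x y = C.form ℤ y x := fun x y => by
    rw [form, form, Finset.sum_comm]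
    refine Finset.sum_congr rfl fun i _ => Finset.sum_congr rfl fun j _ => ?_
    rw [C.symm]
    ring
  simp only [formL₀, Matrix.of_apply]
  rcases lt_trichotomy i j with h | h | h
  · simp [h, h.asymm, hcomm]
  · simp [h]
  · simp [h, h.asymm, hcomm]

theorem formL_skew (i j : Fin w.length) : C.formL w j i = -C.formL w i j := by
  have h0 : (C.formL₀ w).transpose = -C.formL₀ w := by
    ext i j; exact C.formL₀_skew w i j
  have h : (C.formL w).transpose = -C.formL w := by
    rw [formL, Matrix.transpose_mul, Matrix.transpose_mul, h0, Matrix.transpose_transpose]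
    simp [Matrix.mul_assoc]
  exact congrFun (congrFun h i) j

theorem det_formL : (C.formL w).det = (C.formL₀ w).det := by
  rw [formL, Matrix.det_mul, Matrix.det_mul, Matrix.det_transpose, det_minorExponents, one_mul,
    mul_one]

/-- The columns which reduce `formL₀`: differences of exchange vectors for the repeated positions,
unit vectors at the first positions for the last ones. -/
def exchangeMatrix : Matrix (Fin w.length) (Fin w.length) ℤ :=
  Matrix.of fun k n =>
    if IsRepeated w n then C.exchangeVec w n k - C.exchangeVec w (letterSucc w n) k
    else if k = letterSucc w n then 1 else 0

/-- The lowest nonzero entry of column n is ±1 and sits in row `letterSucc w n`. Placing each column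
at its successor thus gives an upper triangular matrix with diagonal entries ±1. -/
theorem isUnit_det_exchangeMatrix : IsUnit (C.exchangeMatrix w).det := by
  let σ := Equiv.ofBijective (letterSucc w)
    (Finite.injective_iff_bijective.1 (letterSucc_injective w))
  have hσ : ∀ n, letterSucc w (σ.symm n) = n := σ.apply_symm_apply
  have htri : ((C.exchangeMatrix w).submatrix id σ.symm).BlockTriangular id := by
    intro k n hkn
    have hkn : n < k := hkn
    rw [Matrix.submatrix_apply, exchangeMatrix, Matrix.of_apply, hσ]
    simp only [id]
    split_ifs with h1 h2
    · have h3 := (letterSucc_mem w h1).1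
      rw [hσ] at h3
      simp [exchangeVec, hkn.asymm, hkn.ne', (h3.trans hkn).asymm, (h3.trans hkn).ne']
    · exact absurd h2 hkn.ne'
    · rfl
  have hdiag : IsUnit ((C.exchangeMatrix w).submatrix id σ.symm).det := by
    rw [Matrix.det_of_isUpperTriangular htri]
    refine (Finset.univ.prod_induction _ IsUnit (fun _ _ => IsUnit.mul) isUnit_one) fun n _ => ?_
    rw [Matrix.submatrix_apply, exchangeMatrix, Matrix.of_apply, hσ]
    simp only [id]
    split_ifs with h1
    · have h3 := (letterSucc_mem w h1).1
      rw [hσ] at h3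
      simp [exchangeVec, h3.asymm, h3.ne']
    · exact isUnit_one
  rw [Matrix.det_permute'] at hdiag
  exact isUnit_of_mul_isUnit_right hdiag

/-- The reduced columns. -/
theorem mul_exchangeMatrix_of_isRepeated (m n : Fin w.length) (h : IsRepeated w n) :
    (minorExponents w * C.formL₀ w * C.exchangeMatrix w) m n =
      if m = n then 2 * C.d (w.get n) else 0 := by
  have hcast : (((minorExponents w * C.formL₀ w * C.exchangeMatrix w) m n : ℤ) : ℝ) =
      (∑ k, ((minorExponents w * C.formL₀ w) m k : ℝ) * C.exchangeVec w n k) -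
        ∑ k, ((minorExponents w * C.formL₀ w) m k : ℝ) * C.exchangeVec w (letterSucc w n) k := by
    rw [Matrix.mul_apply, ← Finset.sum_sub_distrib]
    push_cast
    refine Finset.sum_congr rfl fun k _ => ?_
    rw [exchangeMatrix, Matrix.of_apply, if_pos h]
    push_cast
    ring
  -- Both exchange vectors belong to the same simple root, so the terms (α, Λ + ξ) cancel. For m of
  -- the same letter, the conditions m < n and m < `letterSucc w n` differ only at m = n.
  rw [sum_mul_exchangeVec, sum_mul_exchangeVec, get_letterSucc] at hcast
  have hlt := (letterSucc_mem w h).1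
  have : (((minorExponents w * C.formL₀ w * C.exchangeMatrix w) m n : ℤ) : ℝ) =
      ((if m = n then 2 * C.d (w.get n) else 0 : ℤ) : ℝ) := by
    rw [hcast]
    by_cases hmn : m = n
    · subst hmn
      simp [hlt]
    · rw [if_neg hmn]
      by_cases hl : w.get m = w.get n
      · have : m < n ↔ m < letterSucc w n := by
          refine ⟨fun h1 => h1.trans hlt, fun h1 => ?_⟩
          by_contra h2
          exact absurd (letterSucc_le w h (lt_of_le_of_ne (not_lt.1 h2) (Ne.symm hmn)) hl)
            (not_le.2 h1)
        simp only [this]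
        simp
      · simp only [hl, and_false, if_false]
        simp
  exact_mod_cast this

/-- The remaining columns. -/
theorem mul_exchangeMatrix_of_not_isRepeated (m n : Fin w.length) (h : ¬ IsRepeated w n) :
    (minorExponents w * C.formL₀ w * C.exchangeMatrix w) m n =
      (minorExponents w * C.formL₀ w) m (firstPos w n) := by
  rw [Matrix.mul_apply]
  simp [exchangeMatrix, h, letterSucc_of_not w h]

/-- The transpose of 𝔸 is unimodular, so G can undo it and then apply the reducing columns. Their
determinant ±1 is corrected by a sign. -/
theorem exists_isColumnReduction :
    ∃ (G : Matrix (Fin w.length) (Fin w.length) ℤ) (Y : Matrix (NonLast w) (Last w) ℤ)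
        (Z : Matrix (Last w) (Last w) ℤ) (ε : Last w → ℤˣ),
      C.IsColumnReduction w G Y Z ∧
      ∀ a b : Last w, Z a b =
        (ε b : ℤ) * (minorExponents w * C.formL₀ w) a.1 (firstPos w b.1) := by
  classical
  obtain ⟨u, hu⟩ := C.isUnit_det_exchangeMatrix w
  -- The sign is put on the column of a last occurrence, so that D is unaffected. Such a column
  -- exists unless the word is empty, and then the determinant is already 1.
  obtain ⟨δ, hδ, hprod⟩ : ∃ δ : Fin w.length → ℤˣ, (∀ n, IsRepeated w n → δ n = 1) ∧
      ∏ n, δ n = u := by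
    by_cases hne : ∃ n, ¬ IsRepeated w n
    · obtain ⟨n, hn⟩ := hne
      refine ⟨Pi.mulSingle n u, fun m hm => ?_, by simp⟩
      rw [Pi.mulSingle_eq_of_ne]
      rintro rfl
      exact hn hm
    · have hempty : IsEmpty (Fin w.length) := by
        by_contra hn
        rw [not_isEmpty_iff] at hn
        have hne2 : (Finset.univ : Finset (Fin w.length)).Nonempty := Finset.univ_nonempty
        refine hne ⟨Finset.max' _ hne2, ?_⟩
        rintro ⟨m, h1, -⟩
        exact absurd (Finset.le_max' _ m (Finset.mem_univ m)) (not_le.2 h1)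
      refine ⟨1, fun _ _ => rfl, ?_⟩
      rw [Matrix.det_isEmpty] at hu
      have : u = 1 := Units.ext hu
      simp [this]
  have hAt : (minorExponents w).transpose.det = 1 := by
    rw [Matrix.det_transpose, det_minorExponents]
  let G := (minorExponents w).transpose⁻¹ *
    (C.exchangeMatrix w * Matrix.diagonal fun n => ((δ n : ℤˣ) : ℤ))
  have hLG : C.formL w * G = minorExponents w * C.formL₀ w * C.exchangeMatrix w *
      Matrix.diagonal fun n => ((δ n : ℤˣ) : ℤ) := by
    rw [formL, ← Matrix.mul_assoc, Matrix.mul_nonsing_inv_cancel_right _ _ (by rw [hAt]; simp),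
      Matrix.mul_assoc _ (C.exchangeMatrix w)]
  let e := Equiv.sumCompl (IsRepeated w)
  refine ⟨G, ((C.formL w * G).submatrix e e).toBlocks₁₂, ((C.formL w * G).submatrix e e).toBlocks₂₂,
    fun b => δ b.1, ⟨?_, ?_⟩, ?_⟩
  · rw [Matrix.det_mul, Matrix.det_mul, Matrix.det_diagonal, Matrix.det_nonsing_inv, hAt, ← hu,
      ← Units.coe_prod, hprod]
    simp [← Units.val_mul]
  · have hcol : ∀ m (n : NonLast w), (C.formL w * G) m n.1 =
        if m = n.1 then 2 * C.d (w.get n.1) else 0 := fun m n => by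
      rw [hLG, Matrix.mul_diagonal, mul_exchangeMatrix_of_isRepeated C w m n.1 n.2, hδ _ n.2]
      simp
    conv_lhs => rw [← Matrix.fromBlocks_toBlocks ((C.formL w * G).submatrix _ _)]
    congr 1
    · ext m n
      simp only [Matrix.toBlocks₁₁, Matrix.of_apply, Matrix.submatrix_apply,
        Equiv.sumCompl_apply_inl, hcol, Matrix.diagonal_apply, Subtype.ext_iff]
      split_ifs with h
      · rw [h]
      · rfl
    · ext m n
      have : m.1 ≠ n.1 := fun h => m.2 (h ▸ n.2)
      simp [Matrix.toBlocks₂₁, hcol, this]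
  · intro a b
    simp only [Matrix.toBlocks₂₂, Matrix.of_apply, Matrix.submatrix_apply, e,
      Equiv.sumCompl_apply_inr]
    rw [hLG, Matrix.mul_diagonal, mul_exchangeMatrix_of_not_isRepeated C w _ _ b.2, mul_comm]

/-- The entries of the lower right block. -/
theorem minorExponents_mul_formL₀_firstPos (a b : Last w) :
    ((minorExponents w * C.formL₀ w) a.1 (firstPos w b.1) : ℝ) =
      C.form ℝ ((1 + C.weylElt ℝ w) (C.fundWeight (w.get a.1)))
        ((1 - C.weylElt ℝ (w.take (w.idxOf (w.get b.1) + 1))) (C.fundWeight (w.get b.1))) := by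
  set k := firstPos w b.1 with hk
  have hget : w.get k = w.get b.1 := get_firstPos w b.1
  -- Up to and including its first occurrence the letter c contributes a single root, so Λ_c -
  -- ω_{c,1} Λ_c is that root. The shift by 1 includes the occurrence itself.
  have hright : (1 - C.weylElt ℝ (w.take (w.idxOf (w.get b.1) + 1))) (C.fundWeight (w.get b.1)) =
      C.realRoot w k := by
    rw [LinearMap.sub_apply, Module.End.one_apply,
      ← sum_realRoot_letter C w (w.get b.1) (w.idxOf (w.get b.1) + 1) k.2, Finset.sum_eq_single k]
    · rw [if_pos ⟨Nat.lt_succ_self _, hget⟩, one_smul]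
    · intro j _ hj
      rw [if_neg, zero_smul]
      rintro ⟨h1, h2⟩
      refine hj (le_antisymm ?_ (firstPos_le w h2))
      rw [Fin.le_def]
      exact Nat.lt_succ_iff.1 h1
    · simp
  -- Past its last occurrence the letter s adds no root to the telescoping sum, so all longer
  -- initial parts of the word move Λ_s to the same vector.
  have hstable : ∀ p ≤ w.length, (a.1 : ℕ) < p →
      C.weylElt ℝ (w.take p) (C.fundWeight (w.get a.1)) = C.extremalWeight w a.1 := by
    intro p hp hap
    rw [extremalWeight, ← sub_right_inj (a := C.fundWeight (w.get a.1)),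
      ← sum_realRoot_letter C w _ _ hp, ← sum_realRoot_letter C w _ _ a.1.2]
    refine Finset.sum_congr rfl fun j _ => ?_
    congr 2
    rw [eq_iff_iff]
    refine and_congr_left fun hj => ⟨fun _ => ?_, fun _ => by omega⟩
    by_contra hlt
    exact a.2 ⟨j, by rw [Fin.lt_def]; omega, hj⟩
  have hω : C.weylElt ℝ w (C.fundWeight (w.get a.1)) = C.extremalWeight w a.1 := by
    have := hstable w.length le_rfl a.1.2
    rwa [List.take_length] at this
  rw [hright, form_eq_formB, LinearMap.add_apply, Module.End.one_apply, hω,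
    minorExponents_mul_formL₀, formB_comm _ _ (C.realRoot w k)]
  by_cases hle : k ≤ a.1
  · rw [if_pos hle]
    simp only [map_sub, map_add]
    ring
  · have hlt := not_le.1 hle
    -- Here k comes after the last occurrence of s. Then ξ = ω_{k-1} Λ_s, and the letter at k
    -- differs from s, so the sign of ξ in the entry does not matter.
    have h0 : C.formB (C.realRoot w k) (C.extremalWeight w a.1) = 0 := by
      rw [← hstable k k.2.le hlt, formB_realRoot_weylElt, corootVal_fundWeight, if_neg, mul_zero]
      intro h
      exact a.2 ⟨k, hlt, h⟩
    rw [if_neg hle, map_sub, map_add, h0]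
    ring

/-! ### The kernel of 1 + ω -/

/-- The kernel of `1 + ω` is trivial if and only if the skew form of the roots is nondegenerate. -/
theorem ker_one_add_weylElt_eq_bot_iff :
    LinearMap.ker (1 + C.weylElt ℝ w) = ⊥ ↔ (C.formL₀ w).det ≠ 0 := by
  let P : Matrix ι (Fin w.length) ℝ := Matrix.of fun i k => C.realRoot w k i
  let Q : Matrix (Fin w.length) ι ℝ := Matrix.of fun k j => (C.A (w.get k) j : ℝ)
  -- The lower triangular half of the Gram matrix of the roots, with half of the diagonal value
  -- (β_k, β_k) = 2d.
  let T : Matrix (Fin w.length) (Fin w.length) ℝ := Matrix.of fun k l =>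
    if l < k then C.formB (C.realRoot w l) (C.realRoot w k)
    else if l = k then (C.d (w.get k) : ℝ) else 0
  have hW : LinearMap.toMatrix' (1 + C.weylElt ℝ w) = 2 - P * Q := by
    ext i j
    have h := congrFun (sum_corootVal_smul_realRoot C w (Pi.single j 1) w.length le_rfl) i
    rw [List.take_length] at h
    have h2 : (P * Q) i j = (Pi.single j 1 : ι → ℝ) i - C.weylElt ℝ w (Pi.single j 1) i := by
      rw [Pi.sub_apply] at h
      rw [← h, Matrix.mul_apply, Finset.sum_apply]
      refine Finset.sum_congr rfl fun k _ => ?_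
      rw [if_pos k.2, corootVal_single, Pi.smul_apply, smul_eq_mul, mul_comm]
      rfl
    have h3 : (2 : Matrix ι ι ℝ) i j = 2 * (Pi.single j 1 : ι → ℝ) i := by
      rw [← one_add_one_eq_two, Matrix.add_apply, Matrix.one_apply, Pi.single_apply]
      split_ifs <;> norm_num
    rw [Matrix.sub_apply, h2, h3, LinearMap.toMatrix'_apply, LinearMap.add_apply,
      Module.End.one_apply, Pi.add_apply]
    ring
  -- Pair β_k with the displacement formula for α_j over the letters before k. The remaining term
  -- ω_{k-1} α_j accounts for the diagonal of T.
  have hTQ : ∀ k j, (T * Q) k j = C.formB (C.realRoot w k) (Pi.single j 1) := by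
    intro k j
    have h := sum_corootVal_smul_realRoot C w (Pi.single j 1) k k.2.le
    have hx : (Pi.single j 1 : ι → ℝ) = (∑ l : Fin w.length, (if (l : ℕ) < k then
        C.corootVal (w.get l) (Pi.single j 1) else 0) • C.realRoot w l) +
        C.weylElt ℝ (w.take k) (Pi.single j 1) := by rw [h, sub_add_cancel]
    conv_rhs => rw [hx]
    rw [map_add, formB_realRoot_weylElt, map_sum, Matrix.mul_apply]
    have hpt : ∀ l, T k l * Q l j = C.formB (C.realRoot w k) ((if (l : ℕ) < k then
        C.corootVal (w.get l) (Pi.single j 1) else 0) • C.realRoot w l) +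
        if l = k then (C.d (w.get k) : ℝ) * C.corootVal (w.get k) (Pi.single j 1) else 0 := by
      intro l
      simp only [T, Q, Matrix.of_apply, corootVal_single, map_smul, smul_eq_mul]
      rcases lt_trichotomy l k with h1 | h1 | h1
      · have h1' : (l : ℕ) < k := h1
        rw [if_pos h1, if_pos h1', if_neg h1.ne, C.formB_comm]
        ring
      · subst h1
        simp
      · have h1' : ¬ (l : ℕ) < k := h1.asymm
        rw [if_neg h1.asymm, if_neg h1', if_neg h1.ne', if_neg h1.ne']
        ring
    simp only [hpt, Finset.sum_add_distrib, Finset.sum_ite_eq', Finset.mem_univ, if_true]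
  have hTQP : ∀ k l, (T * Q * P) k l = C.formB (C.realRoot w k) (C.realRoot w l) := by
    intro k l
    have hx : C.realRoot w l = ∑ j, P j l • (Pi.single j 1 : ι → ℝ) := by
      ext i
      simp [P, Finset.sum_apply, Pi.single_apply]
    conv_rhs => rw [hx]
    rw [map_sum, Matrix.mul_apply]
    refine Finset.sum_congr rfl fun j _ => ?_
    rw [hTQ, map_smul, smul_eq_mul, mul_comm]
  -- The product TQP is the Gram matrix of the roots, which equals T plus its transpose. So 2T - TQP
  -- is T minus its transpose, the negative of 𝓛₀.
  have hL : T * (2 - Q * P) = -(C.formL₀ w).map (fun z : ℤ => (z : ℝ)) := by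
    rw [mul_sub, ← Matrix.mul_assoc]
    ext k l
    rw [Matrix.sub_apply, hTQP, Matrix.neg_apply, Matrix.map_apply, formL₀_cast, mul_two,
      Matrix.add_apply]
    simp only [T, Matrix.of_apply]
    rcases lt_trichotomy l k with h1 | h1 | h1
    · rw [if_pos h1, if_neg h1.asymm, if_pos h1, C.formB_comm (C.realRoot w l)]
      ring
    · subst h1
      simp only [lt_irrefl, if_false, if_true, formB_realRoot_self]
      ring
    · rw [if_neg h1.asymm, if_neg h1.ne', if_pos h1]
      ring
  have hT : T.det ≠ 0 := by
    rw [Matrix.det_of_isLowerTriangular]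
    · refine Finset.prod_ne_zero_iff.2 fun k _ => ?_
      simp only [T, Matrix.of_apply, lt_irrefl, if_false, if_true]
      exact_mod_cast (C.d_pos _).ne'
    · intro k l hkl
      have hkl : k < l := hkl
      simp [T, hkl.asymm, hkl.ne']
  rw [← not_iff_not, ← ne_eq, ← LinearMap.det_eq_zero_iff_ker_ne_bot, ← LinearMap.det_toMatrix',
    hW, not_not, ← not_iff_not, ← ne_eq, Matrix.det_two_sub_mul_ne_zero_comm, ← ne_eq]
  have hdet := congrArg Matrix.det hL
  rw [Matrix.det_mul, Matrix.det_neg] at hdet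
  have hmap : ((C.formL₀ w).map (fun z : ℤ => (z : ℝ))).det = ((C.formL₀ w).det : ℝ) :=
    ((Int.castRingHom ℝ).map_det (C.formL₀ w)).symm
  rw [hmap] at hdet
  have h1 : (2 - Q * P).det = 0 ↔ (C.formL₀ w).det = 0 := by
    constructor
    · intro h
      rw [h, mul_zero, eq_comm] at hdet
      have := (mul_eq_zero.1 hdet).resolve_left (pow_ne_zero _ (by norm_num))
      exact_mod_cast this
    · intro h
      rw [h, Int.cast_zero, mul_zero] at hdet
      exact (mul_eq_zero.1 hdet).resolve_left hT
  rw [ne_eq, h1]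

end CartanDatum

/-! ### Determinants and prime exponents of block diagonal forms -/

/-- A plane has determinant p². The factor 0 ^ l comes from the null space and is 1 when l = 0. -/
theorem IsBlockDiagonalForm.det_eq {r : ℕ} {L : Matrix (Fin r) (Fin r) ℤ} {k l : ℕ} {p : Fin k → ℤ}
    (h : IsBlockDiagonalForm L k l p) : L.det = (∏ i, p i ^ 2) * 0 ^ l := by
  obtain ⟨U, e, hU, h⟩ := h
  have h1 := congrArg Matrix.det h
  rw [Matrix.det_submatrix_equiv_self, Matrix.det_mul, Matrix.det_mul, Matrix.det_transpose, hU,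
    Matrix.det_fromBlocks_zero₂₁, Matrix.det_blockDiagonal, one_mul, mul_one] at h1
  rw [h1]
  congr 1
  · refine Finset.prod_congr rfl fun i _ => ?_
    rw [Matrix.det_fin_two_of]
    ring
  · cases l with
    | zero => simp
    | succ l => simp

theorem Nat.Prime.pow_mul_inj {p a b u v : ℕ} (hp : p.Prime) (hu : ¬ p ∣ u) (hv : ¬ p ∣ v)
    (h : p ^ a * u = p ^ b * v) : a = b := by
  have key : ∀ {a b u v : ℕ}, ¬ p ∣ v → p ^ a * u = p ^ b * v → a ≤ b := fun {a b u v} hv h => by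
    have h1 : p ^ a ∣ p ^ b * v := ⟨u, h.symm⟩
    have h2 := (((Nat.Prime.coprime_iff_not_dvd hp).2 hv).pow_left a).dvd_of_dvd_mul_right h1
    exact (Nat.pow_dvd_pow_iff_le_right hp.one_lt).1 h2
  exact le_antisymm (key hv h) (key hu h.symm)

theorem Nat.Prime.not_dvd_prod {p : ℕ} (hp : p.Prime) {κ : Type*} (s : Finset κ) (f : κ → ℕ)
    (h : ∀ i ∈ s, ¬ p ∣ f i) : ¬ p ∣ ∏ i ∈ s, f i := fun hd => by
  obtain ⟨i, hi, h'⟩ := (hp.prime.dvd_finsetProd_iff f).1 hd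
  exact h i hi h'

/-- The exponents of a prime in the blocks of a block diagonal form. -/
theorem IsBlockDiagonalForm.exists_prime_factorization {r : ℕ} {L : Matrix (Fin r) (Fin r) ℤ}
    {k l : ℕ} {p : Fin k → ℤ} (h : IsBlockDiagonalForm L k l p) {p₁ : ℕ} (hp₁ : p₁.Prime)
    {c z : ℤ} (hL : L.det = c * z) (hc : ¬ (p₁ : ℤ) ∣ c) {t : ℕ} (ht : (p₁ : ℤ) ^ t ∣ z)
    (ht' : ¬ (p₁ : ℤ) ^ (t + 1) ∣ z) :
    ∃ u s : Fin k → ℕ,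
      (∀ i, 0 < u i ∧ (u i).Coprime p₁ ∧ (p i).natAbs = u i * p₁ ^ s i) ∧ 2 * ∑ i, s i = t := by
  have hz : z ≠ 0 := fun h0 => ht' (h0 ▸ dvd_zero _)
  have hc0 : c ≠ 0 := fun h0 => hc (h0 ▸ dvd_zero _)
  have hdet : L.det ≠ 0 := by rw [hL]; exact mul_ne_zero hc0 hz
  have hform := h.det_eq
  -- The exact power of p₁ exists only for z ≠ 0, so the determinant is nonzero and no null vectors
  -- occur.
  have hl : l = 0 := by
    by_contra hl
    rw [zero_pow hl, mul_zero] at hform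
    exact hdet hform
  subst hl
  rw [pow_zero, mul_one] at hform
  have hp : ∀ i, (p i).natAbs ≠ 0 := fun i h0 => by
    rw [hform] at hdet
    exact pow_ne_zero_iff two_ne_zero |>.1 (Finset.prod_ne_zero_iff.1 hdet i (Finset.mem_univ i))
      (Int.natAbs_eq_zero.1 h0)
  choose s u hu hsu using fun i => Nat.exists_eq_pow_mul_and_not_dvd (hp i) p₁ hp₁.ne_one
  refine ⟨u, s, fun i => ⟨?_, ?_, ?_⟩, ?_⟩
  · exact Nat.pos_of_ne_zero fun h0 => hu i (h0 ▸ dvd_zero _)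
  · exact ((Nat.Prime.coprime_iff_not_dvd hp₁).2 (hu i)).symm
  · rw [hsu i, mul_comm]
  · obtain ⟨v, rfl⟩ := ht
    have hv : ¬ p₁ ∣ v.natAbs := fun hd => by
      refine ht' ?_
      rw [pow_succ]
      exact mul_dvd_mul_left _ (Int.natCast_dvd.2 hd)
    refine hp₁.pow_mul_inj (u := ∏ i, u i ^ 2) (v := c.natAbs * v.natAbs) ?_ ?_ ?_
    · exact hp₁.not_dvd_prod _ _ fun i _ hd => hu i (hp₁.dvd_of_dvd_pow hd)
    · rw [hp₁.dvd_mul, not_or]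
      exact ⟨fun hd => hc (Int.natCast_dvd.2 hd), hv⟩
    · have h1 : L.det.natAbs = p₁ ^ (2 * ∑ i, s i) * ∏ i, u i ^ 2 := by
        rw [hform, ← Int.natAbsHom_apply, map_prod, mul_comm 2, pow_mul, ← Finset.prod_pow_eq_pow_sum,
          ← Finset.prod_pow, ← Finset.prod_mul_distrib]
        refine Finset.prod_congr rfl fun i _ => ?_
        rw [map_pow, Int.natAbsHom_apply, hsu i, mul_pow]
      rw [← h1, hL, Int.natAbs_mul, Int.natAbs_mul, Int.natAbs_pow, Int.natAbs_natCast]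
      ring

/-! ### The determinant formula and the theorem -/

namespace CartanDatum

variable {ι : Type*} [Fintype ι] [DecidableEq ι] {C : CartanDatum ι} {w : List ι}

theorem IsColumnReduction.det_formL {G : Matrix (Fin w.length) (Fin w.length) ℤ}
    {Y : Matrix (NonLast w) (Last w) ℤ} {Z : Matrix (Last w) (Last w) ℤ}
    (h : C.IsColumnReduction w G Y Z) : (C.formL w).det =
      2 ^ (w.length - w.toFinset.card) * (∏ n : NonLast w, C.d (w.get n.1)) * Z.det := by
  have h1 := congrArg Matrix.det h.2
  rw [Matrix.det_submatrix_equiv_self, Matrix.det_mul, h.1, mul_one, Matrix.det_fromBlocks_zero₂₁,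
    Matrix.det_diagonal, Finset.prod_mul_distrib, Finset.prod_const, Finset.card_univ,
    card_nonLast] at h1
  exact h1

end CartanDatum

theorem mainTheorem9 {ι : Type*} [Fintype ι] [DecidableEq ι] (C : CartanDatum ι)
    (w : List ι) (hw : C.IsReduced w) :
    -- a column reduction exists, and its lower right block has the entries
    -- `± ((1 + ω) Λ_s, (1 - ω_{c,1}) Λ_c)`, the sign depending on the column only
    (∃ (G : Matrix (Fin w.length) (Fin w.length) ℤ) (Y : Matrix (NonLast w) (Last w) ℤ)
        (Z : Matrix (Last w) (Last w) ℤ) (ε : Last w → ℤˣ),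
      C.IsColumnReduction w G Y Z ∧
      ∀ a b : Last w, (Z a b : ℝ) = ((ε b : ℤ) : ℝ) *
        C.form ℝ ((1 + C.weylElt ℝ w) (C.fundWeight (w.get a.1)))
          ((1 - C.weylElt ℝ (w.take (w.idxOf (w.get b.1) + 1))) (C.fundWeight (w.get b.1)))) ∧
    -- a block diagonal form exists
    (∃ (k l : ℕ) (p : Fin k → ℤ), IsBlockDiagonalForm (C.formL w) k l p) ∧
    -- consequences of any column reduction
    ∀ (G : Matrix (Fin w.length) (Fin w.length) ℤ) (Y : Matrix (NonLast w) (Last w) ℤ)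
        (Z : Matrix (Last w) (Last w) ℤ), C.IsColumnReduction w G Y Z →
      (∀ q : ℂ, q ≠ 0 → (∀ n : ℕ, 0 < n → q ^ n ≠ 1) →
        (Subalgebra.center ℂ (QuasiLaurent q (C.formL₀ w)) = ⊥ ↔ Z.det ≠ 0)) ∧
      (LinearMap.ker (1 + C.weylElt ℝ w) = ⊥ ↔ Z.det ≠ 0) ∧
      (C.formL w).det =
        2 ^ (w.length - w.toFinset.card) * (∏ n : NonLast w, C.d (w.get n.1)) * Z.det ∧
      (∀ (k l : ℕ) (p : Fin k → ℤ), IsBlockDiagonalForm (C.formL w) k l p → ∀ i,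
        p i ^ 2 ∣
          2 ^ (w.length - w.toFinset.card) * (∏ n : NonLast w, C.d (w.get n.1)) * Z.det) ∧
      ∀ p₁ : ℕ, p₁.Prime → p₁ ≠ 2 → ¬ (p₁ : ℤ) ∣ ∏ n : NonLast w, C.d (w.get n.1) →
        ∀ t : ℕ, (p₁ : ℤ) ^ t ∣ Z.det → ¬ (p₁ : ℤ) ^ (t + 1) ∣ Z.det →
          Even t ∧
          ∀ (k l : ℕ) (p : Fin k → ℤ), IsBlockDiagonalForm (C.formL w) k l p →
            ∃ u s : Fin k → ℕ,
              (∀ i, 0 < u i ∧ (u i).Coprime p₁ ∧ (p i).natAbs = u i * p₁ ^ s i) ∧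
              2 * ∑ i, s i = t := by
  have hblock := exists_isBlockDiagonalForm (C.formL w) (C.formL_skew w)
  refine ⟨?_, hblock, ?_⟩
  · obtain ⟨G, Y, Z, ε, h, hZ⟩ := C.exists_isColumnReduction w
    refine ⟨G, Y, Z, ε, h, fun a b => ?_⟩
    rw [hZ, Int.cast_mul, C.minorExponents_mul_formL₀_firstPos w a b]
  intro G Y Z h
  have hdet := h.det_formL
  have hd : ∏ n : NonLast w, C.d (w.get n.1) ≠ 0 :=
    Finset.prod_ne_zero_iff.2 fun n _ => (C.d_pos _).ne'
  -- The center and the kernel concern 𝓛₀, the column reduction concerns 𝓛. Their determinants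
  -- agree, and the factors apart from det Z are nonzero.
  have hZ : (C.formL₀ w).det ≠ 0 ↔ Z.det ≠ 0 := by
    rw [← C.det_formL, hdet, mul_ne_zero_iff, mul_ne_zero_iff]
    exact and_iff_right ⟨pow_ne_zero _ two_ne_zero, hd⟩
  refine ⟨fun q hq hroot => ?_, ?_, hdet, fun k l p hp i => ?_, fun p₁ hp₁ h2 hpd t ht ht' => ?_⟩
  · rw [QuasiLaurent.center_eq_bot_iff hq hroot (C.formL₀_skew w), hZ]
  · rw [C.ker_one_add_weylElt_eq_bot_iff, hZ]
  · rw [← hdet, hp.det_eq]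
    exact (Finset.dvd_prod_of_mem (fun i => p i ^ 2) (Finset.mem_univ i)).mul_right _
  · have hc : ¬ (p₁ : ℤ) ∣
        2 ^ (w.length - w.toFinset.card) * ∏ n : NonLast w, C.d (w.get n.1) := by
      have hp₁' := Nat.prime_iff_prime_int.1 hp₁
      rw [hp₁'.dvd_mul, not_or]
      refine ⟨fun hdvd => h2 ?_, hpd⟩
      exact (Nat.prime_dvd_prime_iff_eq hp₁ Nat.prime_two).1
        (by exact_mod_cast hp₁'.dvd_of_dvd_pow hdvd)
    -- Evenness of t does not refer to any block form, so it is read off from one that exists.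
    obtain ⟨k, l, p, hp⟩ := hblock
    obtain ⟨u, s, -, hs⟩ := hp.exists_prime_factorization hp₁ hdet hc ht ht'
    exact ⟨⟨∑ i, s i, by omega⟩, fun k l p hp =>
      hp.exists_prime_factorization hp₁ hdet hc ht ht'⟩
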